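/- Model. In broadcast CONGEST, the nodes of an $n$-node graph $G=(V,E)$ have distinct identifiers from a set of size $n^{\kappa}$ ($\kappa$ a constant) and know $n$ and an upper bound $\Delta$ on the maximum degree. In each synchronous round, every node broadcasts one message of $O(\log n)$ bits to all its neighbors; a node knows the identifier of the sender of each message it receives. Nodes have independent private randomness (each node draws a uniform sample from a finite set that depends on $n$ and $\Delta$), and local computation is unrestricted. For $\epsilon>0$, a set $K\subseteq V$ is an $\epsilon$-almost-clique if $|K|\le(1+\epsilon)\Delta$, $|N(v)\cap K|\ge(1-\epsilon)\Delta$ for all $v\in K$, and $|N(v)\cap K|\le(1-\epsilon/2)\Delta$ for all $v\notin K$. Lemma. Let $0<\epsilon<1/24$, $a>0$, $c>0$ and $\kappa\in\mathbb N$ be constants. There is a broadcast CONGEST algorithm, running in $O(1)$ rounds with $O(\log n)$-bit messages (the constants depend only on $\epsilon,a,c,\kappa$), with the following property. Let $G$ be an $n$-node graph of maximum degree at most $\Delta$, where $\Delta\ge a\ln^3 n$, and let $K_1,K_2,\dots$ be pairwise disjoint $\epsilon$-almost-cliques of $G$, with names from a set of size $n^{\kappa}$. Let $S\subseteq V$ be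 arbitrary, and suppose that each node initially knows its identifier, the name of the almost-clique that contains it (if any), and whether it is in $S$. The algorithm runs on all almost-cliques simultaneously, and for every almost-clique $K$, with $S_K:=S\cap K$, the following holds conditionally on every fixed choice of the random samples of the nodes outside $K$: 1. with probability at least $1-n^{-c}$, the algorithm succeeds in $K$, meaning that there is a bijection $\pi:S_K\to\{1,\dots,|S_K|\}$ such that each $v\in S_K$ outputs $\pi(v)$; 2. the permutation is nearly uniform: for each bijection $\pi:S_K\to\{1,\dots,|S_K|\}$, $$(1-n^{-c})\cdot\Pr[\text{every } v\in S_K \text{ outputs } \pi(v)]\le \frac{\Pr[\text{the algorithm succeeds in } K]}{|S_K|!},$$ i.e. (for $n\ge2$) conditionally on success, $\pi$ is the output with probability at most $\frac{1}{(1-n^{-c})\,|S_K|!}$. -/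

import Mathlib

/-- `K` is an `ε`-almost-clique of `G` with respect to the degree bound `Δ`. -/
structure IsAlmostClique {V : Type*} (G : SimpleGraph V) (ε : ℝ) (Δ : ℕ) (K : Set V) : Prop where
  card_le : (K.ncard : ℝ) ≤ (1 + ε) * Δ
  inside : ∀ v ∈ K, (1 - ε) * Δ ≤ ((G.neighborSet v ∩ K).ncard : ℝ)
  outside : ∀ v ∉ K, ((G.neighborSet v ∩ K).ncard : ℝ) ≤ (1 - ε / 2) * Δ

namespace BCongest

/-- A `b`-bit message. -/
abbrev Msg (b : ℕ) : Type := Fin b → Bool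

/-- What a node receives in one round when identifiers are taken from `Fin N`: for each identifier,
the message broadcast by the neighbor with that identifier (`none` if there is no such neighbor). -/
abbrev Inbox (N b : ℕ) : Type := Fin N → Option (Msg b)

/-- A randomized synchronous protocol in which every node broadcasts one `b`-bit message per round
to all of its neighbors.  Each node draws a private seed, uniformly from a finite set and
independently of the other nodes; local computation is unrestricted. -/
structure Protocol (N b : ℕ) (In Out : Type) where
  /-- private randomness of a node -/
  Seed : Type
  fintypeSeed : Fintype Seed
  nonemptySeed : Nonempty Seed
  /-- local memory of a node -/
  State : Type
  init : In → Seed → State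
  /-- the message that a node in the given state broadcasts -/
  send : State → Msg b
  /-- the new state after receiving the messages of the neighbors -/
  receive : State → Inbox N b → State
  output : State → Out

section Execution

variable {V : Type*} {N b : ℕ} {In Out : Type}

open Classical in
/-- The messages that reach `v` when every node `u` broadcasts `m u`. -/
noncomputable def deliver (G : SimpleGraph V) (ident : V → Fin N) (m : V → Msg b) (v : V) :
    Inbox N b :=
  fun i => if h : ∃ u, G.Adj v u ∧ ident u = i then some (m h.choose) else none

/-- The states of all nodes after `r` rounds, for local inputs `inp` and private seeds `ω`. -/
noncomputable def Protocol.stateAfter (P : Protocol N b In Out) (G : SimpleGraph V)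
    (ident : V → Fin N) (inp : V → In) (ω : V → P.Seed) : ℕ → V → P.State
  | 0, v => P.init (inp v) (ω v)
  | r + 1, v =>
      P.receive (P.stateAfter G ident inp ω r v)
        (deliver G ident (fun u => P.send (P.stateAfter G ident inp ω r u)) v)

/-- The outputs of all nodes after `T` rounds. -/
noncomputable def Protocol.outputAfter (P : Protocol N b In Out) (G : SimpleGraph V)
    (ident : V → Fin N) (inp : V → In) (ω : V → P.Seed) (T : ℕ) (v : V) : Out :=
  P.output (P.stateAfter G ident inp ω T v)

open Classical in
/-- The conditional probability of the event `A` on the seeds, given that the seeds of the nodes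
outside `K` are those of `ω₀`: the seeds of the nodes in `K` are independent and uniform. -/
noncomputable def Protocol.probGivenOutside (P : Protocol N b In Out) (K : Set V)
    (ω₀ : V → P.Seed) (A : Set (V → P.Seed)) : ℝ :=
  (Nat.card {ω : V → P.Seed // (fun v => if v ∈ K then ω v else ω₀ v) ∈ A} : ℝ)
    / Nat.card (V → P.Seed)

end Execution

end BCongest

/-- What a node knows initially, besides `n` and `Δ`: its identifier, the name of the
almost-clique it belongs to (if any), and whether it is one of the nodes to be permuted. -/
structure PermInput (N : ℕ) where
  ident : Fin N
  clique : Option (Fin N)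
  active : Prop

/-- The nodes of `S` output exactly the permutation `π` (with indices `1, …, |S|`). -/
def OutputsPerm {V : Type*} (S : Set V) (out : V → Option ℕ) (π : S ≃ Fin S.ncard) : Prop :=
  ∀ v : S, out v = some ((π v : ℕ) + 1)

/-! Each node draws a random label from a polynomial-size set, and the permutation is the order of
the labels of the active nodes in its almost-clique. Two rounds must therefore tell each active node
all these labels, although it hears only its neighbors directly.

Nodes also draw one of about `Δ / log n` groups, so that group loads are `O(log n)`, and a role,
that is, a group to relay. A relay reports a polynomial fingerprint, at a random point, of the
labels it hears from that group. It may miss some members, so a candidate set `U` is accepted when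
each report is the fingerprint of some subset of `U`. If `U` omits a label that a relay heard, that
relay's report is consistent with `U` only at few evaluation points
(`card_exists_subset_fingerprint_eq_le`). Two nodes of `K` share most of `K` as neighbors, so order
`log n` relays serve each group for them. Their independent points make a wrong `U` survive with
probability `2 ^ (-Ω(log² n))`, which beats the `2 ^ O(log² n)` candidates
(`uprob_exists_not_relaysDetermine_le`). With high probability the seeds are good
(`uprob_not_goodSeeds_le_rpow`), and all active nodes output their true ranks
(`permProtocol_output_eq_rank`).

Near uniformity does not come from conditioning on good seeds, but from one-sided errors. A label
counts as known only if it lies in every accepted set of at most `2 * g` labels. If a group has more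
than `2 * g` members, some node sees more than `g` of them (`exists_lt_card_filter_adj`), and its
alarm silences those members. So when every active node answers, each group's true label set is
itself accepted, no false label is known, and no output exceeds the true rank
(`permProtocol_output_le_rank`). A permutation bounded pointwise by the ranks must equal them
(`strictMono_of_le_card_lt`), so outputting `π` forces the labels to increase along `π`. By symmetry
this has probability at most `1 / s!` (`uprob_strictMono_le`); multiplying by `1 - n ^ (-c) ≤
Pr[success]` gives the claim.

Both arguments use only seeds inside `K`, so they hold for every choice of the seeds outside. -/

/-- The probability of the event `p` under the uniform distribution on `Ω`. -/
noncomputable def uprob {Ω : Type*} (p : Ω → Prop) : ℝ :=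
  (Nat.card {ω : Ω // p ω} : ℝ) / Nat.card Ω

lemma uprob_nonneg {Ω : Type*} (p : Ω → Prop) : 0 ≤ uprob p := by
  unfold uprob; positivity

lemma uprob_comp_equiv {Ω Ω' : Type*} (e : Ω' ≃ Ω) (p : Ω → Prop) :
    uprob (fun ω => p (e ω)) = uprob p := by
  unfold uprob
  rw [Nat.card_congr e, Nat.card_congr (e.subtypeEquiv (q := p) (fun a => Iff.rfl))]

/-! ### Union bounds and moment bounds for uniform samples. -/

section UniformProbability

variable {Ω : Type*} [Finite Ω]

lemma uprob_mono {p q : Ω → Prop} (h : ∀ ω, p ω → q ω) : uprob p ≤ uprob q := by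
  unfold uprob
  gcongr
  exact Nat.card_le_card_of_injective (fun x : {ω // p ω} => (⟨x.1, h _ x.2⟩ : {ω // q ω}))
    (fun a b hab => Subtype.ext (by simpa using hab))

lemma uprob_eq_one_of_forall [Nonempty Ω] {p : Ω → Prop} (h : ∀ ω, p ω) : uprob p = 1 := by
  have : Nat.card {ω : Ω // p ω} = Nat.card Ω :=
    Nat.card_congr (Equiv.subtypeUnivEquiv h)
  unfold uprob
  rw [this, div_self]
  exact_mod_cast Nat.card_pos.ne'

open Classical in
lemma uprob_eq_sum (Ω : Type*) [Fintype Ω] (p : Ω → Prop) :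
    uprob p = (∑ ω : Ω, if p ω then (1 : ℝ) else 0) / Fintype.card Ω := by
  unfold uprob
  rw [Nat.card_eq_fintype_card, Nat.card_eq_fintype_card, Fintype.card_subtype]
  simp

lemma uprob_or_le (p q : Ω → Prop) : uprob (fun ω => p ω ∨ q ω) ≤ uprob p + uprob q := by
  classical
  cases nonempty_fintype Ω
  simp only [uprob_eq_sum]
  rw [← add_div, ← Finset.sum_add_distrib]
  gcongr with ω
  by_cases hp : p ω <;> by_cases hq : q ω <;> simp [hp, hq]

lemma uprob_exists_le {ι : Type*} [Fintype ι] (p : ι → Ω → Prop) :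
    uprob (fun ω => ∃ i, p i ω) ≤ ∑ i, uprob (p i) := by
  classical
  cases nonempty_fintype Ω
  simp only [uprob_eq_sum]
  rw [← Finset.sum_div, Finset.sum_comm]
  gcongr with ω
  have hnn : ∀ i ∈ (Finset.univ : Finset ι), (0 : ℝ) ≤ if p i ω then 1 else 0 := by
    intro i _; split_ifs <;> norm_num
  split_ifs with h
  · obtain ⟨i, hi⟩ := h
    calc (1 : ℝ) = if p i ω then 1 else 0 := by simp [hi]
      _ ≤ _ := Finset.single_le_sum hnn (Finset.mem_univ i)
  · exact Finset.sum_nonneg hnn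

lemma uprob_exists_le_mul {ι : Type*} [Finite ι] (p : ι → Ω → Prop) {δ : ℝ}
    (h : ∀ i, uprob (p i) ≤ δ) : uprob (fun ω => ∃ i, p i ω) ≤ Nat.card ι * δ := by
  cases nonempty_fintype ι
  refine (uprob_exists_le p).trans ((Finset.sum_le_sum fun i _ => h i).trans ?_)
  simp [Nat.card_eq_fintype_card]

lemma one_le_uprob_add_uprob_not [Nonempty Ω] (p : Ω → Prop) :
    1 ≤ uprob p + uprob (fun ω => ¬ p ω) := by
  rw [← uprob_eq_one_of_forall (p := fun ω : Ω => p ω ∨ ¬ p ω) (fun ω => em _)]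
  exact uprob_or_le _ _

/-- An event that is unlikely for every value of the first coordinate is unlikely. -/
lemma uprob_prod_le {α β : Type*} [Finite α] [Finite β] {p : α × β → Prop} {δ : ℝ} (hδ : 0 ≤ δ)
    (h : ∀ a, uprob (fun b => p (a, b)) ≤ δ) : uprob p ≤ δ := by
  classical
  cases nonempty_fintype α
  cases nonempty_fintype β
  simp only [uprob_eq_sum] at h ⊢
  rcases (Nat.eq_zero_or_pos (Fintype.card α * Fintype.card β)) with h0 | h0
  · rw [Fintype.card_prod, h0]
    simpa using hδ
  have ha : (0 : ℝ) < Fintype.card α := by exact_mod_cast Nat.pos_of_mul_pos_right h0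
  have hb : (0 : ℝ) < Fintype.card β := by exact_mod_cast Nat.pos_of_mul_pos_left h0
  rw [Fintype.card_prod, Nat.cast_mul, div_le_iff₀ (mul_pos ha hb), Fintype.sum_prod_type]
  calc _ ≤ ∑ _a : α, δ * Fintype.card β :=
        Finset.sum_le_sum fun a _ => (div_le_iff₀ hb).1 (h a)
    _ = _ := by simp; ring

/-- Exponential moment bound for independent uniform samples. -/
lemma uprob_le_mul_pow {V R : Type*} [Fintype V] [Fintype R] [Nonempty R] (p : (V → R) → Prop)
    (C : Finset V) (f : V → R → ℝ) (hf : ∀ v ∈ C, ∀ s, 0 ≤ f v s) (M q : ℝ) (hM : 0 ≤ M)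
    (hp : ∀ ω, p ω → 1 ≤ M * ∏ v ∈ C, f v (ω v))
    (hq : ∀ v ∈ C, ∑ s, f v s ≤ q * Fintype.card R) : uprob p ≤ M * q ^ C.card := by
  classical
  have hc : (0 : ℝ) < Fintype.card R := by exact_mod_cast Fintype.card_pos
  rw [uprob_eq_sum, div_le_iff₀ (by exact_mod_cast Fintype.card_pos)]
  -- Weight 1 off `C` turns the moment into a product over all coordinates, so the sum over `ω`
  -- factorizes.
  let g : V → R → ℝ := fun v s => if v ∈ C then f v s else 1
  have hg : ∀ ω : V → R, ∏ v, g v (ω v) = ∏ v ∈ C, f v (ω v) := by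
    intro ω
    simp only [g]
    rw [← Finset.prod_filter_mul_prod_filter_not Finset.univ (· ∈ C)]
    rw [Finset.prod_congr rfl (g := fun v => f v (ω v)) (by
      intro v hv; simp [(Finset.mem_filter.1 hv).2])]
    rw [Finset.prod_congr rfl (g := fun v => (1 : ℝ)) (s₁ := Finset.filter (· ∉ C) _) (by
      intro v hv; simp [(Finset.mem_filter.1 hv).2])]
    simp
  have hg0 : ∀ v s, 0 ≤ g v s := by
    intro v s; simp only [g]; split_ifs with h
    · exact hf v h s
    · exact zero_le_one
  calc (∑ ω : V → R, if p ω then (1 : ℝ) else 0) ≤ ∑ ω : V → R, M * ∏ v, g v (ω v) := by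
        gcongr with ω
        split_ifs with h
        · rw [hg]; exact hp ω h
        · exact mul_nonneg hM (Finset.prod_nonneg fun v _ => hg0 _ _)
    _ = M * ∏ v, ∑ s, g v s := by
        rw [← Finset.mul_sum, Finset.prod_univ_sum, Fintype.piFinset_univ]
    _ ≤ M * ∏ v, ((if v ∈ C then q else 1) * (Fintype.card R : ℝ)) := by
        gcongr with v
        · intro v _; exact Finset.sum_nonneg fun s _ => hg0 _ _
        · simp only [g]
          split_ifs with h
          · exact hq v h
          · simp
    _ = M * q ^ C.card * Fintype.card (V → R) := by
        rw [Finset.prod_mul_distrib, Finset.prod_ite_mem]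
        simp [mul_assoc]

end UniformProbability

/-! ### Ranks and random orders. -/

section Order

/-- If every index is at most the rank of its value, then the values are strictly increasing. -/
lemma strictMono_of_le_card_lt {Y : Type*} [LinearOrder Y] {s : ℕ} (f : Fin s → Y)
    (h : ∀ i : Fin s, (i : ℕ) ≤ (Finset.univ.filter fun k => f k < f i).card) : StrictMono f := by
  classical
  -- The ranks sum to the number of pairs with distinct values, at most the number of all pairs,
  -- which is the sum of the indices. The pointwise inequalities are then all equalities.
  have hsum : ∑ i : Fin s, (Finset.univ.filter fun k => f k < f i).card ≤ ∑ i : Fin s, (i : ℕ) := by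
    have h1 : ∀ i : Fin s, (i : ℕ) = (Finset.univ.filter fun k : Fin s => k < i).card := by
      intro i
      rw [show (Finset.univ.filter fun k : Fin s => k < i) = Finset.Iio i by ext; simp]
      simp
    have h2 : ∀ (r : Fin s → Fin s → Prop) [DecidableRel r],
        2 * ∑ i : Fin s, (Finset.univ.filter fun k => r k i).card
          = ∑ i : Fin s, ∑ k : Fin s, ((if r k i then 1 else 0) + (if r i k then 1 else 0)) := by
      intro r _
      simp only [Finset.card_filter, Finset.sum_add_distrib, two_mul]
      congr 1
      exact Finset.sum_comm
    have h3 : 2 * ∑ i : Fin s, (Finset.univ.filter fun k => f k < f i).card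
        ≤ 2 * ∑ i : Fin s, (Finset.univ.filter fun k : Fin s => k < i).card := by
      rw [h2 (fun k i => f k < f i), h2 (fun k i => k < i)]
      refine Finset.sum_le_sum fun i _ => Finset.sum_le_sum fun k _ => ?_
      rcases lt_trichotomy k i with hk | hk | hk
      · rcases lt_trichotomy (f k) (f i) with hf | hf | hf <;>
          simp [hk, hk.not_gt, hf, hf.not_gt]
      · subst hk; simp
      · rcases lt_trichotomy (f k) (f i) with hf | hf | hf <;>
          simp [hk, hk.not_gt, hf, hf.not_gt]
    rw [Finset.sum_congr rfl fun i _ => h1 i]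
    omega
  have heq : ∀ i : Fin s, (i : ℕ) = (Finset.univ.filter fun k => f k < f i).card := by
    have := (Finset.sum_eq_sum_iff_of_le (s := Finset.univ) (fun i _ => h i)).1
      (le_antisymm (Finset.sum_le_sum fun i _ => h i) hsum)
    exact fun i => this i (Finset.mem_univ i)
  intro i j hij
  by_contra hcon
  have : (j : ℕ) ≤ i := by
    rw [heq i, heq j]
    refine Finset.card_le_card fun k hk => ?_
    simp only [Finset.mem_filter, Finset.mem_univ, true_and] at hk ⊢
    exact hk.trans_le (not_lt.1 hcon)
  exact absurd hij (not_lt.2 this)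

/-- Independent uniform samples are increasing along a given enumeration with probability at most
one over the number of enumerations. -/
lemma uprob_strictMono_le {V R Y : Type*} [Finite V] [Finite R] [Nonempty R] [LinearOrder Y]
    (y : R → Y) {T : Set V} {s : ℕ} (π : T ≃ Fin s) :
    uprob (fun ω : V → R => StrictMono fun i => y (ω (π.symm i))) ≤ 1 / (s.factorial : ℝ) := by
  classical
  -- Permuting the coordinates in `T` of an increasing sample gives `s!` samples. The pair `(σ, ω)`
  -- can be recovered, because an increasing sequence is determined by its range.
  let τ : Equiv.Perm (Fin s) → Equiv.Perm V := fun σ =>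
    σ.extendDomain (p := fun v => v ∈ T) π.symm
  have hτ : ∀ σ i, τ σ (π.symm i) = π.symm (σ i) := fun σ i =>
    Equiv.Perm.extendDomain_apply_image σ π.symm i
  let Φ : Equiv.Perm (Fin s) × {ω : V → R // StrictMono fun i => y (ω (π.symm i))} → (V → R) :=
    fun x => x.2.1 ∘ τ x.1
  have hΦ : Function.Injective Φ := by
    rintro ⟨σ, ω, hω⟩ ⟨σ', ω', hω'⟩ h
    have hfun : ∀ i, y (ω (π.symm (σ i))) = y (ω' (π.symm (σ' i))) := by
      intro i
      have := congrFun h (π.symm i)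
      simp only [Φ, Function.comp, hτ] at this
      rw [this]
    have hr : (fun i => y (ω (π.symm i))) = fun i => y (ω' (π.symm i)) := by
      refine (StrictMono.range_inj hω hω').1 ?_
      rw [← EquivLike.range_comp _ σ, ← EquivLike.range_comp (fun i => y (ω' (π.symm i))) σ']
      congr 1
      exact funext hfun
    have hσ : σ = σ' := by
      ext i
      have h1 := hfun i
      rw [show y (ω' (π.symm (σ' i))) = y (ω (π.symm (σ' i))) from (congrFun hr (σ' i)).symm] at h1
      rw [hω.injective h1]
    subst hσ
    have hωω : ω = ω' := by
      funext v
      have := congrFun h ((τ σ).symm v)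
      simpa [Φ] using this
    subst hωω
    rfl
  have hcard := Nat.card_le_card_of_injective Φ hΦ
  rw [Nat.card_prod, Nat.card_eq_fintype_card (α := Equiv.Perm (Fin s)), Fintype.card_perm,
    Fintype.card_fin] at hcard
  unfold uprob
  have hpos : (0 : ℝ) < Nat.card (V → R) := by exact_mod_cast Nat.card_pos
  rw [div_le_div_iff₀ hpos (by positivity), mul_comm, one_mul]
  exact_mod_cast hcard

end Order

/-! ### Double counting in almost-cliques. -/

section Neighborhoods

variable {V : Type*} (G : SimpleGraph V) [DecidableRel G.Adj]

/-- In an almost-clique some node is adjacent to more than half of any given nonempty set. -/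
lemma exists_lt_card_filter_adj {ε δ : ℝ} (hε : ε < 1 / 24) (hδ : 0 < δ)
    {K T : Finset V} (hTK : T ⊆ K) (hK : (K.card : ℝ) ≤ (1 + ε) * δ)
    (hdeg : ∀ u ∈ K, (1 - ε) * δ ≤ ((K.filter fun w => G.Adj u w).card : ℝ))
    {g : ℕ} (hT : 2 * g < T.card) : ∃ w ∈ K, g < (T.filter fun u => G.Adj w u).card := by
  by_contra! hcon
  -- Count the edges between `K` and `T` from both sides: at least `(2g + 1)(1 - ε)δ`, but at most
  -- `(1 + ε)δg` if the claim fails.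
  have h1 : ∑ w ∈ K, (T.filter fun u => G.Adj w u).card
      = ∑ u ∈ T, (K.filter fun w => G.Adj u w).card := by
    simp only [Finset.card_filter]
    rw [Finset.sum_comm]
    simp only [G.adj_comm]
  have h2 : ((∑ w ∈ K, (T.filter fun u => G.Adj w u).card : ℕ) : ℝ) ≤ K.card * g := by
    exact_mod_cast (Finset.sum_le_sum hcon).trans (by simp)
  have h3 : (T.card : ℝ) * ((1 - ε) * δ)
      ≤ ((∑ u ∈ T, (K.filter fun w => G.Adj u w).card : ℕ) : ℝ) := by
    push_cast
    calc _ = ∑ u ∈ T, ((1 - ε) * δ) := by simp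
      _ ≤ _ := Finset.sum_le_sum fun u hu => hdeg u (hTK hu)
  rw [h1] at h2
  have h4 : (K.card : ℝ) * g ≤ (1 + ε) * δ * g := by gcongr
  have h5 : (2 * g + 1 : ℝ) ≤ T.card := by exact_mod_cast hT
  have h6 : (2 * g + 1 : ℝ) * ((1 - ε) * δ) ≤ T.card * ((1 - ε) * δ) := by
    gcongr
    nlinarith
  have h7 : (2 * g + 1 : ℝ) * (1 - ε) * δ ≤ (1 + ε) * g * δ := by linarith
  have h8 : (2 * g + 1 : ℝ) * (1 - ε) ≤ (1 + ε) * g := le_of_mul_le_mul_right h7 hδ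
  have hg : (0 : ℝ) ≤ g := by positivity
  nlinarith

/-- Two nodes of an almost-clique have most of the almost-clique as common neighbors. -/
lemma le_card_common_neighbors [DecidableEq V] {ε δ : ℝ} {K : Finset V} (hK : (K.card : ℝ) ≤ (1 + ε) * δ)
    (hdeg : ∀ u ∈ K, (1 - ε) * δ ≤ ((K.filter fun w => G.Adj u w).card : ℝ))
    {u v : V} (hu : u ∈ K) (hv : v ∈ K) :
    (1 - 3 * ε) * δ ≤ ((K.filter fun w => G.Adj w u ∧ G.Adj v w).card : ℝ) := by
  have h1 := Finset.card_union_add_card_inter (K.filter fun w => G.Adj u w)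
    (K.filter fun w => G.Adj v w)
  have h2 : ((K.filter fun w => G.Adj u w) ∪ (K.filter fun w => G.Adj v w)).card ≤ K.card :=
    Finset.card_le_card (Finset.union_subset (Finset.filter_subset _ _) (Finset.filter_subset _ _))
  rw [← Finset.filter_and] at h1
  have h3 : (K.filter fun w => G.Adj w u ∧ G.Adj v w) = K.filter fun w => G.Adj u w ∧ G.Adj v w := by
    simp only [G.adj_comm _ u]
  rw [h3]
  have hu' := hdeg u hu
  have hv' := hdeg v hv
  have h4 : (K.filter fun w => G.Adj u w).card + (K.filter fun w => G.Adj v w).card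
      ≤ K.card + (K.filter fun w => G.Adj u w ∧ G.Adj v w).card := by omega
  have h5 : ((K.filter fun w => G.Adj u w).card : ℝ) + (K.filter fun w => G.Adj v w).card
      ≤ K.card + (K.filter fun w => G.Adj u w ∧ G.Adj v w).card := by exact_mod_cast h4
  linarith

end Neighborhoods

/-! ### Polynomial fingerprints of label sets. -/

section Fingerprints

lemma card_finset_card_le (Q g : ℕ) :
    Nat.card {U : Finset (Fin Q) // U.card ≤ g} ≤ (Q + 1) ^ g := by
  classical
  have : Function.Surjective (fun φ : Fin g → Option (Fin Q) =>
      (⟨Finset.eraseNone (Finset.univ.image φ), by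
        refine (Finset.card_eraseNone_le _).trans (Finset.card_image_le.trans (by simp))⟩ :
        {U : Finset (Fin Q) // U.card ≤ g})) := by
    rintro ⟨U, hU⟩
    refine ⟨fun i => U.toList[(i : ℕ)]?, ?_⟩
    ext y
    simp only [Finset.mem_eraseNone, Finset.mem_image, Finset.mem_univ, true_and]
    rw [← Finset.mem_toList, List.mem_iff_getElem?]
    constructor
    · rintro ⟨i, hi⟩; exact ⟨i, hi⟩
    · rintro ⟨i, hi⟩
      have hlt := (List.getElem?_eq_some_iff.1 hi).1
      rw [Finset.length_toList] at hlt
      exact ⟨⟨i, hlt.trans_le hU⟩, hi⟩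
  refine (Nat.card_le_card_of_surjective _ this).trans ?_
  simp

variable {Q : ℕ} {F : Type*} [Field F]

/-- The value at `s` of the monic polynomial with root set `A`. -/
def fingerprint (e : Fin Q ↪ F) (s : F) (A : Finset (Fin Q)) : F := ∏ a ∈ A, (s - e a)

-- The monic polynomials with root sets `A` and `B` are distinct, so their difference is nonzero and
-- has at most `max |A| |B|` roots.
open Polynomial in
lemma card_fingerprint_eq_le [Fintype F] [DecidableEq F] (e : Fin Q ↪ F) {A B : Finset (Fin Q)}
    (hAB : A ≠ B) : (Finset.univ.filter fun s => fingerprint e s A = fingerprint e s B).card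
      ≤ max A.card B.card := by
  classical
  let p : Finset (Fin Q) → F[X] := fun A => ∏ a ∈ A, (X - C (e a))
  have hp : ∀ A s, (p A).eval s = fingerprint e s A := by
    intro A s; simp [p, fingerprint, eval_prod]
  have hdeg : ∀ A, (p A).natDegree = A.card := fun A => by
    simp [p]
  have hne : p A - p B ≠ 0 := by
    intro h
    apply hAB
    have h' : ∀ a, a ∈ A ↔ a ∈ B := by
      intro a
      have h1 : ∀ A, (p A).eval (e a) = 0 ↔ a ∈ A := by
        intro A
        rw [hp, fingerprint, Finset.prod_eq_zero_iff]
        constructor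
        · rintro ⟨b, hb, hb'⟩
          rwa [e.injective (sub_eq_zero.1 hb')]
        · intro ha; exact ⟨a, ha, sub_self _⟩
      rw [← h1 A, ← h1 B, sub_eq_zero.1 h]
    exact Finset.ext h'
  calc _ ≤ (p A - p B).roots.toFinset.card := by
        refine Finset.card_le_card fun s hs => ?_
        simp only [Finset.mem_filter, Finset.mem_univ, true_and] at hs
        simp [hne, hp, hs, IsRoot]
    _ ≤ (p A - p B).natDegree := (Multiset.toFinset_card_le _).trans (card_roots' _)
    _ ≤ _ := by rw [← hdeg A, ← hdeg B]; exact natDegree_sub_le _ _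

/-- No subset `B` of `U` equals `A`, so the root count applies to each of the at most `2 ^ g`
subsets. -/
lemma card_exists_subset_fingerprint_eq_le [Fintype F] [DecidableEq F] (e : Fin Q ↪ F)
    {A U : Finset (Fin Q)} (hAU : ¬ A ⊆ U) {n g : ℕ} (hA : A.card ≤ n) (hU : U.card ≤ g)
    [DecidablePred fun s => ∃ B ⊆ U, fingerprint e s B = fingerprint e s A] :
    (Finset.univ.filter fun s => ∃ B ⊆ U, fingerprint e s B = fingerprint e s A).card
      ≤ 2 ^ g * (n + g) := by
  calc _ ≤ (U.powerset.biUnion fun B =>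
        Finset.univ.filter fun s => fingerprint e s B = fingerprint e s A).card := by
        refine Finset.card_le_card fun s hs => ?_
        simpa using hs
    _ ≤ ∑ B ∈ U.powerset, (n + g) := by
        refine Finset.card_biUnion_le.trans (Finset.sum_le_sum fun B hB => ?_)
        have hB := Finset.mem_powerset.1 hB
        refine (card_fingerprint_eq_le e (A := B) (B := A) (fun h => hAU (h ▸ hB))).trans ?_
        have := Finset.card_le_card hB
        omega
    _ ≤ _ := by
        rw [Finset.sum_const, Finset.card_powerset, smul_eq_mul]
        gcongr
        norm_num

end Fingerprints

/-! ### Tail bounds for loads, relays and false fingerprints. -/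

section Sampling

variable {V R : Type*} [Fintype V] [Fintype R] [Nonempty R]

/-- Upper tail of the load of a group. -/
lemma uprob_lt_card_filter_eq_le {m : ℕ} (t : R → Fin m) (i : Fin m)
    (ht : ((Finset.univ.filter fun s => t s = i).card : ℝ) * m = Fintype.card R)
    (S : Finset V) (g : ℕ) :
    uprob (fun ω : V → R => g < (S.filter fun u => t (ω u) = i).card)
      ≤ 2⁻¹ ^ g * (1 + 1 / (m : ℝ)) ^ S.card := by
  classical
  have hm : (0 : ℝ) < m := by exact_mod_cast i.pos
  refine uprob_le_mul_pow _ S (fun _ s => if t s = i then 2 else 1) ?_ _ _ (by positivity) ?_ ?_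
  · intro v _ s; positivity
  · intro ω hω
    rw [Finset.prod_ite]
    simp only [Finset.prod_const, one_pow, mul_one]
    calc (1 : ℝ) = 2⁻¹ ^ g * 2 ^ g := by rw [← mul_pow]; norm_num
      _ ≤ _ := by
        gcongr
        norm_num
  · intro v _
    rw [← Finset.sum_congr rfl (fun s _ => show (1 + if t s = i then (1:ℝ) else 0) = _ by
      split_ifs <;> norm_num)]
    rw [Finset.sum_add_distrib, ← ht]
    simp only [Finset.sum_const, Finset.card_univ, nsmul_eq_mul, mul_one, Finset.sum_boole]
    rw [← ht]
    field_simp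
    rfl

/-- Lower tail of the number of relays of a group. -/
lemma uprob_card_filter_eq_lt_le {m : ℕ} (t : R → Fin m) (i : Fin m)
    (ht : ((Finset.univ.filter fun s => t s = i).card : ℝ) * m = Fintype.card R)
    (S : Finset V) (g : ℕ) :
    uprob (fun ω : V → R => (S.filter fun u => t (ω u) = i).card < g)
      ≤ 2 ^ g * (1 - 1 / (2 * m : ℝ)) ^ S.card := by
  classical
  have hm : (0 : ℝ) < m := by exact_mod_cast i.pos
  refine uprob_le_mul_pow _ S (fun _ s => if t s = i then 2⁻¹ else 1) ?_ _ _ (by positivity) ?_ ?_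
  · intro v _ s; positivity
  · intro ω hω
    rw [Finset.prod_ite]
    simp only [Finset.prod_const, one_pow, mul_one]
    calc (1 : ℝ) = 2 ^ g * 2⁻¹ ^ g := by rw [← mul_pow]; norm_num
      _ ≤ _ := by
        gcongr 2 ^ g * ?_
        exact pow_le_pow_of_le_one (by norm_num) (by norm_num) hω.le
  · intro v _
    rw [← Finset.sum_congr rfl (fun s _ => show (1 - 2⁻¹ * if t s = i then (1:ℝ) else 0) = _ by
      split_ifs <;> norm_num)]
    rw [Finset.sum_sub_distrib, ← Finset.mul_sum, ← ht]
    simp only [Finset.sum_const, Finset.card_univ, nsmul_eq_mul, mul_one, Finset.sum_boole]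
    rw [← ht]
    apply le_of_eq
    field_simp

lemma uprob_eq_apply_le {Q : ℕ} (y : R → Fin Q)
    (hy : ∀ i, ((Finset.univ.filter fun s => y s = i).card : ℝ) * Q = Fintype.card R)
    {u v : V} (huv : u ≠ v) : uprob (fun ω : V → R => y (ω u) = y (ω v)) ≤ 1 / (Q : ℝ) := by
  classical
  have hQ : (0 : ℝ) < Q := by exact_mod_cast (y (Classical.arbitrary R)).pos
  have h1 : ∀ i : Fin Q, uprob (fun ω : V → R => y (ω u) = i ∧ y (ω v) = i) ≤ 1 * (1 / (Q : ℝ)) ^ 2 := by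
    intro i
    rw [← Finset.card_pair huv]
    refine uprob_le_mul_pow _ {u, v} (fun _ s => if y s = i then 1 else 0) ?_ _ _ zero_le_one ?_ ?_
    · intro v _ s; positivity
    · rintro ω ⟨h1, h2⟩
      simp [Finset.prod_pair huv, h1, h2]
    · intro w _
      rw [Finset.sum_boole, ← hy i]
      apply le_of_eq
      field_simp
  calc _ ≤ uprob (fun ω : V → R => ∃ i, y (ω u) = i ∧ y (ω v) = i) :=
        uprob_mono fun ω h => ⟨_, h, rfl⟩
    _ ≤ _ := uprob_exists_le_mul _ h1
    _ = _ := by rw [Nat.card_fin]; field_simp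

/-- Independent fingerprints by many relays are unlikely to be all consistent with a wrong set. -/
lemma uprob_forall_relay_consistent_le {m Q : ℕ} {F : Type*} [Field F] [Fintype F]
    (e : Fin Q ↪ F) (C : Finset V) (A : V → Finset (Fin Q)) (U : Finset (Fin Q)) (i : Fin m)
    {n g D X l : ℕ} (hAU : ∀ w ∈ C, ¬ A w ⊆ U) (hA : ∀ w ∈ C, (A w).card ≤ n) (hU : U.card ≤ g)
    (hF : 2 ^ (D * X) * (2 ^ g * (n + g)) ≤ Fintype.card F) :
    uprob (fun ω : V → Fin m × F => l ≤ D * (C.filter fun w => (ω w).1 = i).card ∧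
        ∀ w ∈ C, (ω w).1 = i → ∃ B ⊆ U, fingerprint e (ω w).2 B = fingerprint e (ω w).2 (A w))
      ≤ 2⁻¹ ^ (X * l) := by
  classical
  have : Nonempty (Fin m) := ⟨i⟩
  rw [show (2⁻¹ : ℝ) ^ (X * l) = 2⁻¹ ^ (X * l) * 1 ^ C.card by simp]
  -- A relay of group `i` multiplies the weight by `2 ^ (D * X)` if its report is consistent and by
  -- 0 otherwise. By `hF` each factor has mean at most 1, while on the event the product is at least
  -- `2 ^ (X * l)`.
  refine uprob_le_mul_pow _ C (fun w s => if s.1 = i then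
    (if ∃ B ⊆ U, fingerprint e s.2 B = fingerprint e s.2 (A w) then (2 : ℝ) ^ (D * X) else 0)
    else 1) ?_ _ _ (by positivity) ?_ ?_
  · intro v _ s; positivity
  · rintro ω ⟨h1, h2⟩
    rw [Finset.prod_ite]
    rw [Finset.prod_congr rfl (g := fun _ => (2 : ℝ) ^ (D * X)) (by
      intro w hw
      rw [Finset.mem_filter] at hw
      rw [if_pos (h2 w hw.1 hw.2)])]
    simp only [Finset.prod_const, one_pow, mul_one]
    rw [← pow_mul]
    calc (1 : ℝ) = 2⁻¹ ^ (X * l) * 2 ^ (X * l) := by rw [← mul_pow]; norm_num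
      _ ≤ _ := by
        have : X * l ≤ D * X * (C.filter fun w => (ω w).1 = i).card := by
          calc X * l ≤ X * (D * (C.filter fun w => (ω w).1 = i).card) := Nat.mul_le_mul_left _ h1
            _ = _ := by ring
        gcongr
        norm_num
  · intro w hw
    rw [Fintype.sum_prod_type, one_mul, Fintype.card_prod, Fintype.card_fin]
    have h1 : ∀ r : Fin m, (∑ s : F, if r = i then
        (if ∃ B ⊆ U, fingerprint e s B = fingerprint e s (A w) then (2 : ℝ) ^ (D * X) else 0)
        else 1) ≤ Fintype.card F := by
      intro r
      split_ifs with hr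
      · rw [← Finset.sum_filter, Finset.sum_const, nsmul_eq_mul]
        have := card_exists_subset_fingerprint_eq_le e (hAU w hw) (hA w hw) hU
        have h3 := (Nat.mul_le_mul_left (2 ^ (D * X)) this).trans hF
        rw [mul_comm]
        exact_mod_cast h3
      · simp
    refine (Finset.sum_le_sum fun r _ => h1 r).trans ?_
    simp

end Sampling

open BCongest

/-! ### The two-round protocol. -/

section PermutationProtocol

/-- The messages of the permutation protocol.  A greeting carries the almost-clique of the sender,
whether it is active, its group and its label.  A report carries the almost-clique of the sender,
the group it reports on, the evaluation point and the value of the fingerprint of the labels heard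
from that group, and whether some group is overloaded. -/
abbrev PermMsg (N m Q : ℕ) (F : Type) : Type :=
  (Option (Fin N) × Bool × Fin m × Fin Q) ⊕ (Option (Fin N) × Fin m × F × F × Bool)

/-- The private randomness of a node: its group and label, and its role and evaluation point. -/
abbrev PermSeed (m Q : ℕ) (F : Type) : Type := (Fin m × Fin Q) × (Fin m × F)

/-- The memory of a node. -/
structure PermState (N b m Q : ℕ) (F : Type) where
  inp : PermInput N
  seed : PermSeed m Q F
  round : ℕ
  greetings : Inbox N b
  reports : Inbox N b

variable {N b m Q : ℕ} {F : Type} (enc : PermMsg N m Q F → Msg b)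

open Classical in
/-- The labels in group `i` among the greetings from active nodes of the almost-clique `j`. -/
noncomputable def groupLabels (x : Inbox N b) (j : Option (Fin N)) (i : Fin m) : Finset (Fin Q) :=
  Finset.univ.filter fun y => ∃ k, x k = some (enc (Sum.inl (j, true, i, y)))

open Classical in
/-- More than `g` active nodes of the almost-clique `j` sent greetings from the same group. -/
def Overloaded (g : ℕ) (x : Inbox N b) (j : Option (Fin N)) : Prop :=
  ∃ i, g < (Finset.univ.filter fun k => ∃ y, x k = some (enc (Sum.inl (j, true, i, y)))).card

/-- The reports from the almost-clique `j` on group `i` admit that `U` is its set of labels. -/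
def Consistent [Field F] (e : Fin Q ↪ F) (x : Inbox N b) (j : Option (Fin N)) (i : Fin m)
    (U : Finset (Fin Q)) : Prop :=
  ∀ k s f o, x k = some (enc (Sum.inr (j, i, s, f, o))) → ∃ B ⊆ U, fingerprint e s B = f

open Classical in
/-- The labels that belong to every consistent label set of some group. -/
noncomputable def knownLabels [Field F] (e : Fin Q ↪ F) (g : ℕ) (x : Inbox N b)
    (j : Option (Fin N)) : Finset (Fin Q) :=
  Finset.univ.filter fun y =>
    ∃ i : Fin m, ∀ U : Finset (Fin Q), U.card ≤ 2 * g → Consistent enc e x j i U → y ∈ U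

/-- Some report from the almost-clique `j` announces an overloaded group. -/
def Alarm (x : Inbox N b) (j : Option (Fin N)) : Prop :=
  ∃ k i s f, x k = some (enc (Sum.inr (j, i, s, f, true)))

open Classical in
/-- Each node learns the labels of its almost-clique in two rounds and outputs the rank of its own
label. -/
noncomputable def permProtocol [NeZero m] [NeZero Q] [Field F] [Fintype F] (e : Fin Q ↪ F)
    (g : ℕ) : Protocol N b (PermInput N) (Option ℕ) where
  Seed := PermSeed m Q F
  fintypeSeed := inferInstance
  nonemptySeed := inferInstance
  State := PermState N b m Q F
  init inp seed := ⟨inp, seed, 0, fun _ => none, fun _ => none⟩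
  send σ :=
    if σ.round = 0 then
      enc (Sum.inl (σ.inp.clique, decide σ.inp.active, σ.seed.1.1, σ.seed.1.2))
    else
      enc (Sum.inr (σ.inp.clique, σ.seed.2.1, σ.seed.2.2,
        fingerprint e σ.seed.2.2 (groupLabels enc σ.greetings σ.inp.clique σ.seed.2.1),
        decide (Overloaded enc g σ.greetings σ.inp.clique)))
  receive σ x :=
    if σ.round = 0 then { σ with round := 1, greetings := x }
    else { σ with round := σ.round + 1, reports := x }
  output σ :=
    if Alarm enc σ.reports σ.inp.clique then none
    else some (((knownLabels enc e g σ.reports σ.inp.clique).filter (· < σ.seed.1.2)).card + 1)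

end PermutationProtocol

/-! ### Reading an inbox. -/

section Delivery

lemma deliver_eq_some_iff {V : Type*} {N b : ℕ} (G : SimpleGraph V) {ident : V → Fin N}
    (hid : Function.Injective ident) (msg : V → Msg b) (v : V) (k : Fin N) (x : Msg b) :
    deliver G ident msg v k = some x ↔ ∃ u, G.Adj v u ∧ ident u = k ∧ msg u = x := by
  unfold deliver
  split_ifs with h
  · rw [Option.some_inj]
    constructor
    · intro hx; exact ⟨h.choose, h.choose_spec.1, h.choose_spec.2, hx⟩
    · rintro ⟨u, _, hu, hx⟩
      rw [← hx, hid (hu.trans h.choose_spec.2.symm)]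
  · simp only [false_iff]
    rintro ⟨u, h1, h2, _⟩
    exact h ⟨u, h1, h2⟩

end Delivery

/-! ### What greetings and reports reveal about the almost-clique. -/

section Run

variable {V : Type*} {N b m Q : ℕ} {F : Type}
  (enc : PermMsg N m Q F → Msg b) (g : ℕ) (G : SimpleGraph V)
  (ident : V → Fin N) (clique : V → Option (Fin N)) (S : Set V) (ω : V → PermSeed m Q F)

open Classical in
/-- The greetings received by `v`. -/
noncomputable def greetingsAt (v : V) : Inbox N b :=
  deliver G ident (fun u => enc (Sum.inl (clique u, decide (u ∈ S), (ω u).1.1, (ω u).1.2))) v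

open Classical in
/-- The reports received by `v`. -/
noncomputable def reportsAt [Field F] (e : Fin Q ↪ F) (v : V) : Inbox N b :=
  deliver G ident (fun w => enc (Sum.inr (clique w, (ω w).2.1, (ω w).2.2,
    fingerprint e (ω w).2.2
      (groupLabels enc (greetingsAt enc G ident clique S ω w) (clique w) (ω w).2.1),
    decide (Overloaded enc g (greetingsAt enc G ident clique S ω w) (clique w))))) v

open Classical in
lemma permProtocol_outputAfter_two [NeZero m] [NeZero Q] [Field F] [Fintype F] (e : Fin Q ↪ F)
    (v : V) :
    (permProtocol enc e g).outputAfter G ident (fun v => ⟨ident v, clique v, v ∈ S⟩) ω 2 v =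
      if Alarm enc (reportsAt enc g G ident clique S ω e v) (clique v) then none
      else some (((knownLabels enc e g (reportsAt enc g G ident clique S ω e v) (clique v)).filter
        (· < (ω v).1.2)).card + 1) := by
  simp only [Protocol.outputAfter, Protocol.stateAfter, permProtocol, reportsAt, greetingsAt]
  rfl

variable {enc ident clique S ω} {K : Finset V} {j : Fin N}

open Classical in
lemma groupLabels_greetingsAt (henc : Function.Injective enc)
    (hid : Function.Injective ident) (hK : ∀ v, v ∈ K ↔ clique v = some j) (w : V) (i : Fin m) :
    groupLabels enc (greetingsAt enc G ident clique S ω w) (some j) i =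
      ((K.filter (· ∈ S)).filter fun u => G.Adj w u ∧ (ω u).1.1 = i).image fun u => (ω u).1.2 := by
  ext y
  simp only [groupLabels, greetingsAt, Finset.mem_filter, Finset.mem_univ, true_and,
    Finset.mem_image, hK, deliver_eq_some_iff G hid, henc.eq_iff, Sum.inl.injEq, Prod.mk.injEq,
    decide_eq_true_eq]
  constructor
  · rintro ⟨k, u, h1, h2, h3, h4, h5, h6⟩
    exact ⟨u, ⟨⟨h3, h4⟩, h1, h5⟩, h6⟩
  · rintro ⟨u, ⟨⟨h3, h4⟩, h1, h5⟩, h6⟩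
    exact ⟨_, u, h1, rfl, h3, h4, h5, h6⟩

open Classical in
lemma overloaded_greetingsAt (henc : Function.Injective enc)
    (hid : Function.Injective ident) (hK : ∀ v, v ∈ K ↔ clique v = some j) (w : V) :
    Overloaded enc g (greetingsAt enc G ident clique S ω w) (some j) ↔
      ∃ i, g < (((K.filter (· ∈ S)).filter fun u => (ω u).1.1 = i).filter
        fun u => G.Adj w u).card := by
  unfold Overloaded
  refine exists_congr fun i => ?_
  rw [← Finset.card_image_of_injective
    (((K.filter (· ∈ S)).filter fun u => (ω u).1.1 = i).filter fun u => G.Adj w u) hid]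
  suffices h : (Finset.univ.filter fun k => ∃ y, greetingsAt enc G ident clique S ω w k
      = some (enc (Sum.inl (some j, true, i, y)))) = _ by rw [h]
  ext k
  simp only [greetingsAt, Finset.mem_filter, Finset.mem_univ, true_and,
    Finset.mem_image, hK, deliver_eq_some_iff G hid, henc.eq_iff, Sum.inl.injEq, Prod.mk.injEq,
    decide_eq_true_eq]
  constructor
  · rintro ⟨y, u, h1, h2, h3, h4, h5, h6⟩
    exact ⟨u, ⟨⟨⟨h3, h4⟩, h5⟩, h1⟩, h2⟩
  · rintro ⟨u, ⟨⟨⟨h3, h4⟩, h5⟩, h1⟩, h2⟩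
    exact ⟨_, u, h1, h2, h3, h4, h5, rfl⟩

open Classical in
lemma alarm_reportsAt [Field F] (e : Fin Q ↪ F) (henc : Function.Injective enc)
    (hid : Function.Injective ident) (hK : ∀ v, v ∈ K ↔ clique v = some j) (v : V) :
    Alarm enc (reportsAt enc g G ident clique S ω e v) (some j) ↔
      ∃ w ∈ K, G.Adj v w ∧ ∃ i, g < (((K.filter (· ∈ S)).filter fun u => (ω u).1.1 = i).filter
        fun u => G.Adj w u).card := by
  simp only [Alarm, reportsAt, deliver_eq_some_iff G hid, henc.eq_iff, Sum.inr.injEq,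
    Prod.mk.injEq, decide_eq_true_eq]
  constructor
  · rintro ⟨k, i, s, f, w, h1, h2, h3, h4, h5, h6, h7⟩
    refine ⟨w, (hK w).2 h3, h1, ?_⟩
    rw [h3] at h7
    exact (overloaded_greetingsAt g G henc hid hK w).1 h7
  · rintro ⟨w, h3, h1, h⟩
    have h3 := (hK w).1 h3
    refine ⟨_, _, _, _, w, h1, rfl, h3, rfl, rfl, rfl, ?_⟩
    rw [h3]
    exact (overloaded_greetingsAt g G henc hid hK w).2 h

open Classical in
lemma consistent_reportsAt [Field F] (e : Fin Q ↪ F) (henc : Function.Injective enc)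
    (hid : Function.Injective ident) (hK : ∀ v, v ∈ K ↔ clique v = some j) (v : V) (i : Fin m)
    (U : Finset (Fin Q)) :
    Consistent enc e (reportsAt enc g G ident clique S ω e v) (some j) i U ↔
      ∀ w ∈ K, G.Adj v w → (ω w).2.1 = i → ∃ B ⊆ U, fingerprint e (ω w).2.2 B =
        fingerprint e (ω w).2.2 (((K.filter (· ∈ S)).filter
          fun u => G.Adj w u ∧ (ω u).1.1 = i).image fun u => (ω u).1.2) := by
  simp only [Consistent, reportsAt, deliver_eq_some_iff G hid, henc.eq_iff, Sum.inr.injEq,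
    Prod.mk.injEq]
  constructor
  · intro h w hw hvw hi
    have hw' := (hK w).1 hw
    obtain ⟨B, hB, hB'⟩ := h (ident w) (ω w).2.2 _ _ ⟨w, hvw, rfl, hw', hi, rfl, rfl, rfl⟩
    refine ⟨B, hB, ?_⟩
    rw [hB', hw', hi, groupLabels_greetingsAt G henc hid hK]
  · rintro h k s f o ⟨w, hvw, h2, hw, hi, rfl, rfl, rfl⟩
    rw [hw, hi, groupLabels_greetingsAt G henc hid hK]
    exact h w ((hK w).2 hw) hvw hi

end Run

/-! ### From ranks of labels to permutations. -/

section Ranking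

variable {V : Type*} {Q : ℕ} {T : Set V} {P : Finset V} {y : V → Fin Q} {out : V → Option ℕ}

/-- Distinct labels have distinct ranks, so the ranks form a permutation. -/
lemma exists_outputsPerm_of_rank (hP : ∀ v, v ∈ P ↔ v ∈ T) (hy : Set.InjOn y P)
    (hout : ∀ v ∈ P, out v = some ((P.filter fun u => y u < y v).card + 1)) :
    ∃ π : T ≃ Fin T.ncard, OutputsPerm T out π := by
  have hT : (P : Set V) = T := Set.ext hP
  have hcard : T.ncard = P.card := by rw [← hT, Set.ncard_coe_finset]
  have hlt : ∀ v : T, (P.filter fun u => y u < y v).card < T.ncard := by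
    intro v
    rw [hcard]
    refine Finset.card_lt_card (Finset.filter_ssubset.2 ⟨v, (hP v).2 v.2, lt_irrefl _⟩)
  let f : T → Fin T.ncard := fun v => ⟨(P.filter fun u => y u < y v).card, hlt v⟩
  have hmono : ∀ u ∈ P, ∀ v, y u < y v →
      (P.filter fun w => y w < y u).card < (P.filter fun w => y w < y v).card := by
    intro u hu v huv
    refine Finset.card_lt_card (Finset.ssubset_iff_of_subset ?_ |>.2 ⟨u, ?_, ?_⟩)
    · exact Finset.monotone_filter_right _ fun w _ hw => lt_trans hw huv
    · simp [hu, huv]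
    · simp
  have hinj : Function.Injective f := by
    intro u v huv
    have huv' : (P.filter fun w => y w < y u).card = (P.filter fun w => y w < y v).card :=
      congrArg Fin.val huv
    have hu := (hP u).2 u.2
    have hv := (hP v).2 v.2
    rcases lt_trichotomy (y u) (y v) with h | h | h
    · exact absurd huv' (hmono u hu v h).ne
    · exact Subtype.ext (hy hu hv h)
    · exact absurd huv' (hmono v hv u h).ne'
  have : Finite T := by rw [← hT]; infer_instance
  have hbij : Function.Bijective f :=
    (Nat.bijective_iff_injective_and_card f).2 ⟨hinj, by
      rw [Nat.card_eq_fintype_card (α := Fin _), Fintype.card_fin]; rfl⟩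
  exact ⟨Equiv.ofBijective f hbij, fun v => hout v ((hP v).2 v.2)⟩

/-- A permutation whose values do not exceed the ranks of the labels is the order of the labels. -/
lemma OutputsPerm.strictMono (hP : ∀ v, v ∈ P ↔ v ∈ T) {π : T ≃ Fin T.ncard}
    (hπ : OutputsPerm T out π)
    (hout : ∀ v ∈ P, ∀ r, out v = some (r + 1) → r ≤ (P.filter fun u => y u < y v).card) :
    StrictMono fun i => y (π.symm i) := by
  classical
  refine strictMono_of_le_card_lt _ fun i => ?_
  have h := hout (π.symm i) ((hP _).2 (π.symm i).2) _ (hπ _)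
  rw [π.apply_symm_apply] at h
  refine h.trans ?_
  -- The rank counted over nodes is transported to indices by `π`; the default `i` is never reached.
  refine Finset.card_le_card_of_injOn (fun u => if hu : u ∈ T then π ⟨u, hu⟩ else i) ?_ ?_
  · intro u hu
    simp only [Finset.coe_filter, Set.mem_ofPred_eq] at hu
    have hu' := (hP u).1 hu.1
    simp [hu', hu.2]
  · intro u hu u' hu' huu
    simp only [Finset.coe_filter, Set.mem_ofPred_eq] at hu hu'
    have h1 := (hP u).1 hu.1
    have h2 := (hP u').1 hu'.1
    simpa [h1, h2] using huu

end Ranking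

/-! ### Exact ranks on good seeds, and one-sided errors always. -/

section Correctness

variable {V : Type*} {N b m Q : ℕ} [NeZero m] [NeZero Q] {F : Type} [Field F] [Fintype F]
  {enc : PermMsg N m Q F → Msg b} (e : Fin Q ↪ F) (g : ℕ) (G : SimpleGraph V)
  {ident : V → Fin N} {clique : V → Option (Fin N)} {S : Set V} {ω : V → PermSeed m Q F}
  {K : Finset V} {j : Fin N}

open Classical in
/-- If no group is large, labels are distinct, and the relays determine all labels, then every
active node outputs the rank of its label. -/
lemma permProtocol_output_eq_rank (henc : Function.Injective enc) (hid : Function.Injective ident)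
    (hK : ∀ v, v ∈ K ↔ clique v = some j)
    (hload : ∀ i, ((K.filter (· ∈ S)).filter fun u => (ω u).1.1 = i).card ≤ g)
    (hinj : Set.InjOn (fun u => (ω u).1.2) (K.filter (· ∈ S)))
    (hrel : ∀ u ∈ K.filter (· ∈ S), ∀ v ∈ K, ∀ U : Finset (Fin Q), U.card ≤ 2 * g →
      (∀ w ∈ K.filter (fun w => G.Adj w u ∧ G.Adj v w), (ω w).2.1 = (ω u).1.1 →
        ∃ B ⊆ U, fingerprint e (ω w).2.2 B =
        fingerprint e (ω w).2.2 (((K.filter (· ∈ S)).filter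
          fun u' => G.Adj w u' ∧ (ω u').1.1 = (ω u).1.1).image fun u => (ω u).1.2)) →
      (ω u).1.2 ∈ U) {v : V} (hv : v ∈ K.filter (· ∈ S)) :
    (permProtocol enc e g).outputAfter G ident (fun v => ⟨ident v, clique v, v ∈ S⟩) ω 2 v =
      some (((K.filter (· ∈ S)).filter fun u => (ω u).1.2 < (ω v).1.2).card + 1) := by
  have hvK := (Finset.mem_filter.1 hv).1
  rw [permProtocol_outputAfter_two, (hK v).1 hvK, if_neg]
  · congr 2
    rw [← Finset.card_image_of_injOn (s := (K.filter (· ∈ S)).filter _)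
      (f := fun u => (ω u).1.2) (hinj.mono (by
      exact_mod_cast Finset.filter_subset _ _))]
    congr 1
    ext y
    simp only [Finset.mem_filter (p := (· < (ω v).1.2)), Finset.mem_image, knownLabels,
      Finset.mem_filter_univ, consistent_reportsAt g G e henc hid hK]
    constructor
    · rintro ⟨⟨i, hi⟩, hlt⟩
      -- The true label set of group `i` is consistent, since each relay fingerprints a subset of
      -- it. Testing against it shows that no false label is known.
      have := hi (((K.filter (· ∈ S)).filter fun u => (ω u).1.1 = i).image fun u => (ω u).1.2)
        (Finset.card_image_le.trans ((hload i).trans (by omega))) (fun w hw _ _ => ⟨_, ?_, rfl⟩)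
      · obtain ⟨u, hu, rfl⟩ := Finset.mem_image.1 this
        exact ⟨u, Finset.mem_filter.2 ⟨(Finset.mem_filter.1 hu).1, hlt⟩, rfl⟩
      · exact Finset.image_subset_image (Finset.monotone_filter_right _ fun u _ hu => hu.2)
    · rintro ⟨u, hu, rfl⟩
      obtain ⟨hu, hlt⟩ := Finset.mem_filter.1 hu
      refine ⟨⟨(ω u).1.1, fun U hU hc => hrel u hu v hvK U hU fun w hw hr => ?_⟩, hlt⟩
      obtain ⟨hw, -, hvw⟩ := Finset.mem_filter.1 hw
      exact hc w hw hvw hr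
  · rw [alarm_reportsAt g G e henc hid hK]
    rintro ⟨w, -, -, i, hi⟩
    exact absurd ((Finset.card_le_card (Finset.filter_subset _ _)).trans (hload i)) (not_le.2 hi)

open Classical in
/-- Whenever all active nodes have an output, no output exceeds the rank of the label. -/
lemma permProtocol_output_le_rank (henc : Function.Injective enc) (hid : Function.Injective ident)
    (hK : ∀ v, v ∈ K ↔ clique v = some j)
    (hhalf : ∀ T ⊆ K, 2 * g < T.card → ∃ w ∈ K, g < (T.filter fun u => G.Adj w u).card)
    (hsome : ∀ v ∈ K.filter (· ∈ S), (permProtocol enc e g).outputAfter G ident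
      (fun v => ⟨ident v, clique v, v ∈ S⟩) ω 2 v ≠ none)
    {v : V} (hv : v ∈ K.filter (· ∈ S)) {r : ℕ}
    (hr : (permProtocol enc e g).outputAfter G ident
      (fun v => ⟨ident v, clique v, v ∈ S⟩) ω 2 v = some (r + 1)) :
    r ≤ ((K.filter (· ∈ S)).filter fun u => (ω u).1.2 < (ω v).1.2).card := by
  have hload : ∀ i, ((K.filter (· ∈ S)).filter fun u => (ω u).1.1 = i).card ≤ 2 * g := by
    intro i
    by_contra! hi
    -- Such a `w` raises an alarm, and any member `u` of the group adjacent to `w` hears it and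
    -- outputs nothing.
    obtain ⟨w, hw, hwg⟩ := hhalf _ ((Finset.filter_subset _ _).trans (Finset.filter_subset _ _)) hi
    obtain ⟨u, hu⟩ := Finset.card_pos.1 (g.zero_le.trans_lt hwg)
    obtain ⟨hu, hwu⟩ := Finset.mem_filter.1 hu
    have hu := (Finset.mem_filter.1 hu).1
    refine hsome u hu ?_
    rw [permProtocol_outputAfter_two, (hK u).1 (Finset.mem_filter.1 hu).1, if_pos]
    exact (alarm_reportsAt g G e henc hid hK u).2 ⟨w, hw, hwu.symm, i, hwg⟩
  have hvK := (Finset.mem_filter.1 hv).1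
  rw [permProtocol_outputAfter_two, (hK v).1 hvK] at hr
  split_ifs at hr with hal
  rw [Option.some_inj, add_left_inj] at hr
  rw [← hr]
  refine le_trans (b := (((K.filter (· ∈ S)).filter fun u => (ω u).1.2 < (ω v).1.2).image
    fun u => (ω u).1.2).card) (Finset.card_le_card (fun y hy => ?_)) Finset.card_image_le
  simp only [Finset.mem_filter (p := (· < (ω v).1.2)), knownLabels,
      Finset.mem_filter_univ, consistent_reportsAt g G e henc hid hK] at hy
  obtain ⟨⟨i, hi⟩, hlt⟩ := hy
  have := hi (((K.filter (· ∈ S)).filter fun u => (ω u).1.1 = i).image fun u => (ω u).1.2)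
    (Finset.card_image_le.trans (hload i)) (fun w hw _ _ => ⟨_, ?_, rfl⟩)
  · obtain ⟨u, hu, rfl⟩ := Finset.mem_image.1 this
    exact Finset.mem_image.2 ⟨u, Finset.mem_filter.2 ⟨(Finset.mem_filter.1 hu).1, hlt⟩, rfl⟩
  · exact Finset.image_subset_image (Finset.monotone_filter_right _ fun u _ hu => hu.2)

end Correctness

/-! ### Probability that the seeds are bad. -/

section FailureProbability

variable {V : Type*} [Fintype V] {m Q : ℕ} {F : Type} [Fintype F]

lemma card_group_filter_mul (i : Fin m) :
    ((Finset.univ.filter fun s : PermSeed m Q F => s.1.1 = i).card : ℝ) * m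
      = Fintype.card (PermSeed m Q F) := by
  have : (Finset.univ.filter fun s : PermSeed m Q F => s.1.1 = i)
      = (({i} : Finset (Fin m)) ×ˢ (Finset.univ : Finset (Fin Q))) ×ˢ
        (Finset.univ : Finset (Fin m × F)) := by
    ext s
    simp only [Finset.mem_filter, Finset.mem_univ, true_and, Finset.mem_product,
      Finset.mem_singleton, and_true]
  rw [this]
  simp only [Finset.card_product, Finset.card_singleton, Finset.card_univ, Fintype.card_prod,
    Fintype.card_fin]
  push_cast
  ring

lemma card_label_filter_mul (y : Fin Q) :
    ((Finset.univ.filter fun s : PermSeed m Q F => s.1.2 = y).card : ℝ) * Q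
      = Fintype.card (PermSeed m Q F) := by
  have : (Finset.univ.filter fun s : PermSeed m Q F => s.1.2 = y)
      = ((Finset.univ : Finset (Fin m)) ×ˢ ({y} : Finset (Fin Q))) ×ˢ
        (Finset.univ : Finset (Fin m × F)) := by
    ext s
    simp only [Finset.mem_filter, Finset.mem_univ, true_and, Finset.mem_product,
      Finset.mem_singleton, and_true]
  rw [this]
  simp only [Finset.card_product, Finset.card_singleton, Finset.card_univ, Fintype.card_prod,
    Fintype.card_fin]
  push_cast
  ring

lemma card_role_filter_mul (i : Fin m) :
    ((Finset.univ.filter fun s : PermSeed m Q F => s.2.1 = i).card : ℝ) * m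
      = Fintype.card (PermSeed m Q F) := by
  have : (Finset.univ.filter fun s : PermSeed m Q F => s.2.1 = i)
      = (Finset.univ : Finset (Fin m × Fin Q)) ×ˢ
        (({i} : Finset (Fin m)) ×ˢ (Finset.univ : Finset F)) := by
    ext s
    simp only [Finset.mem_filter, Finset.mem_univ, true_and, Finset.mem_product,
      Finset.mem_singleton, and_true]
  rw [this]
  simp only [Finset.card_product, Finset.card_singleton, Finset.card_univ, Fintype.card_prod,
    Fintype.card_fin]
  push_cast
  ring

variable [Field F]

lemma uprob_exists_overloaded_le [NeZero m] [NeZero Q] (P : Finset V) (g : ℕ) :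
    uprob (fun ω : V → PermSeed m Q F => ∃ i, g < (P.filter fun u => (ω u).1.1 = i).card)
      ≤ m * (2⁻¹ ^ g * (1 + 1 / (m : ℝ)) ^ P.card) := by
  refine (uprob_exists_le_mul _ fun i => uprob_lt_card_filter_eq_le
    (fun s : PermSeed m Q F => s.1.1) i (card_group_filter_mul i) P g).trans ?_
  rw [Nat.card_fin]

lemma uprob_not_injOn_label_le [NeZero m] [NeZero Q] (P : Finset V) :
    uprob (fun ω : V → PermSeed m Q F => ¬ Set.InjOn (fun u => (ω u).1.2) P)
      ≤ (P.card : ℝ) ^ 2 * (1 / (Q : ℝ)) := by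
  classical
  calc _ ≤ uprob (fun ω : V → PermSeed m Q F => ∃ p : P × P, p.1.1 ≠ p.2.1 ∧
        (ω p.1.1).1.2 = (ω p.2.1).1.2) := by
        refine uprob_mono fun ω h => ?_
        simp only [Set.InjOn, not_forall] at h
        obtain ⟨u, hu, v, hv, huv, hne⟩ := h
        exact ⟨(⟨u, hu⟩, ⟨v, hv⟩), hne, huv⟩
    _ ≤ _ := by
        refine (uprob_exists_le_mul (δ := 1 / (Q : ℝ)) _ fun p => ?_).trans ?_
        · by_cases hp : p.1.1 = p.2.1
          · refine le_trans (le_of_eq ?_) (by positivity : (0 : ℝ) ≤ 1 / (Q : ℝ))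
            simp [uprob, hp]
          · exact (uprob_mono fun ω h => h.2).trans (uprob_eq_apply_le
              (fun s : PermSeed m Q F => s.1.2) card_label_filter_mul hp)
        · simp [sq]

variable (G : SimpleGraph V) (e : Fin Q ↪ F)

open Classical in
/-- The reports of the common neighbors of `u` and `v` in `K` on the group of `u` admit that `U` is
its set of labels. -/
def RelaysAdmit (K P : Finset V) (ω : V → PermSeed m Q F) (u v : V) (U : Finset (Fin Q)) : Prop :=
  ∀ w ∈ K.filter (fun w => G.Adj w u ∧ G.Adj v w), (ω w).2.1 = (ω u).1.1 →
    ∃ B ⊆ U, fingerprint e (ω w).2.2 B =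
    fingerprint e (ω w).2.2 ((P.filter
      fun u' => G.Adj w u' ∧ (ω u').1.1 = (ω u).1.1).image fun u => (ω u).1.2)

open Classical in
/-- The number of common neighbors of `u` and `v` in `K` with role `i`. -/
noncomputable def relayCount (K : Finset V) (ω : V → PermSeed m Q F) (u v : V) (i : Fin m) : ℕ :=
  ((K.filter (fun w => G.Adj w u ∧ G.Adj v w)).filter fun w => (ω w).2.1 = i).card

/-- The reports of the common neighbors of `u` and `v` in `K` determine the label of `u`. -/
def RelaysDetermine (K P : Finset V) (g : ℕ) (ω : V → PermSeed m Q F) (u v : V) : Prop :=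
  ∀ U : Finset (Fin Q), U.card ≤ g → RelaysAdmit G e K P ω u v U → (ω u).1.2 ∈ U

-- Freezing groups and labels fixes the set that each relay would fingerprint for the group of `u`,
-- while roles and evaluation points remain independent and uniform. Every common neighbor hears
-- `u`, so its set is not contained in a `U` that omits the label of `u`.
open Classical in
lemma uprob_wrong_set_consistent_le (K P : Finset V) {g D X l : ℕ}
    (hF : 2 ^ (D * X) * (2 ^ g * (P.card + g)) ≤ Fintype.card F) {u v : V} (hu : u ∈ P)
    (U : Finset (Fin Q)) (hU : U.card ≤ g) :
    uprob (fun ω : V → PermSeed m Q F => (ω u).1.2 ∉ U ∧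
      l ≤ D * relayCount G K ω u v (ω u).1.1 ∧ RelaysAdmit G e K P ω u v U)
      ≤ 2⁻¹ ^ (X * l) := by
  rw [← uprob_comp_equiv (Equiv.arrowProdEquivProdArrow V (fun _ => Fin m × Fin Q)
    (fun _ => Fin m × F)).symm]
  refine uprob_prod_le (by positivity) fun a => ?_
  by_cases ha : (a u).2 ∈ U
  · refine le_trans (le_of_eq ?_) (by positivity : (0 : ℝ) ≤ 2⁻¹ ^ (X * l))
    simp [uprob, Equiv.arrowProdEquivProdArrow, ha]
  · refine (uprob_mono fun ω h => ?_).trans (uprob_forall_relay_consistent_le e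
      (K.filter (fun w => G.Adj w u ∧ G.Adj v w))
      (fun w => (P.filter fun u' => G.Adj w u' ∧ (a u').1 = (a u).1).image fun u => (a u).2)
      U (a u).1 (n := P.card) (g := g) (D := D) (X := X) (l := l) ?_ ?_ hU hF)
    · exact ⟨h.2.1, h.2.2⟩
    · intro w hw hsub
      refine ha (hsub (Finset.mem_image.2 ⟨u, ?_, rfl⟩))
      exact Finset.mem_filter.2 ⟨hu, (Finset.mem_filter.1 hw).2.1, rfl⟩
    · intro w _
      exact Finset.card_image_le.trans (Finset.card_le_card (Finset.filter_subset _ _))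

/-- For a fixed pair, either some role has too few relays among the common neighbors, or one of at
most `(Q + 1) ^ g` sets is wrong yet admitted. The factor `|K| ^ 2` pays for the pairs. -/
lemma uprob_exists_not_relaysDetermine_le (K P : Finset V) (hPK : P ⊆ K) {g D X l : ℕ} {δ : ℝ} (hδ : 0 ≤ δ)
    (hF : 2 ^ (D * X) * (2 ^ g * (P.card + g)) ≤ Fintype.card F)
    (hfew : ∀ u ∈ K, ∀ v ∈ K, ∀ i : Fin m, uprob (fun ω : V → PermSeed m Q F =>
      D * relayCount G K ω u v i < l)
        ≤ δ) :
    uprob (fun ω : V → PermSeed m Q F => ∃ u ∈ P, ∃ v ∈ K, ¬ RelaysDetermine G e K P g ω u v)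
      ≤ (K.card : ℝ) ^ 2 * (m * δ + (Q + 1) ^ g * 2⁻¹ ^ (X * l)) := by
  have hP : (P.card : ℝ) ≤ K.card := by exact_mod_cast Finset.card_le_card hPK
  have hb : ∀ p : P × K, uprob (fun ω : V → PermSeed m Q F =>
      ¬ RelaysDetermine G e K P g ω p.1.1 p.2.1) ≤ m * δ + (Q + 1) ^ g * 2⁻¹ ^ (X * l) := by
    rintro ⟨⟨u, hu⟩, ⟨v, hv⟩⟩
    refine (uprob_mono fun ω h => ?_).trans ((uprob_or_le
      (fun ω : V → PermSeed m Q F => ∃ i : Fin m, D * relayCount G K ω u v i < l)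
      (fun ω : V → PermSeed m Q F => ∃ U : {U : Finset (Fin Q) // U.card ≤ g}, (ω u).1.2 ∉ U.1 ∧
        l ≤ D * relayCount G K ω u v (ω u).1.1 ∧ RelaysAdmit G e K P ω u v U.1)).trans
      (add_le_add ?_ ?_))
    · by_cases hl : D * relayCount G K ω u v (ω u).1.1 < l
      · exact Or.inl ⟨_, hl⟩
      · simp only [RelaysDetermine, not_forall] at h
        obtain ⟨U, hU, hc, hmem⟩ := h
        exact Or.inr ⟨⟨U, hU⟩, hmem, not_lt.1 hl, hc⟩
    · refine (uprob_exists_le_mul _ fun i => hfew u (hPK hu) v hv i).trans ?_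
      rw [Nat.card_fin]
    · have h2 : ∀ U : {U : Finset (Fin Q) // U.card ≤ g}, uprob (fun ω : V → PermSeed m Q F =>
          (ω u).1.2 ∉ U.1 ∧ l ≤ D * relayCount G K ω u v (ω u).1.1 ∧
          RelaysAdmit G e K P ω u v U.1) ≤ 2⁻¹ ^ (X * l) :=
        fun U => uprob_wrong_set_consistent_le G e K P hF hu U.1 U.2
      refine (uprob_exists_le_mul _ h2).trans ?_
      have := card_finset_card_le Q g
      exact mul_le_mul_of_nonneg_right (by exact_mod_cast this) (by positivity)
  calc _ ≤ uprob (fun ω : V → PermSeed m Q F => ∃ p : P × K,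
        ¬ RelaysDetermine G e K P g ω p.1.1 p.2.1) :=
        uprob_mono fun ω ⟨u, hu, v, hv, h⟩ => ⟨(⟨u, hu⟩, ⟨v, hv⟩), h⟩
    _ ≤ _ := uprob_exists_le_mul _ hb
    _ ≤ _ := by
        rw [Nat.card_prod, Nat.card_eq_fintype_card, Nat.card_eq_fintype_card, Fintype.card_coe,
          Fintype.card_coe, Nat.cast_mul, sq]
        gcongr

end FailureProbability

/-! ### Good seeds depend only on the seeds inside the almost-clique. -/

section Congruence

variable {V : Type*} {m Q : ℕ} {F : Type} [Field F] (G : SimpleGraph V) (e : Fin Q ↪ F)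

lemma RelaysAdmit.congr {K P : Finset V} (hPK : P ⊆ K) {ω ω' : V → PermSeed m Q F}
    (h : ∀ v ∈ K, ω v = ω' v) {u v : V} (hu : u ∈ K) {U : Finset (Fin Q)}
    (hU : RelaysAdmit G e K P ω u v U) : RelaysAdmit G e K P ω' u v U := by
  classical
  intro w hw hr
  have hwK := (Finset.mem_filter.1 hw).1
  rw [← h w hwK, ← h u hu] at hr
  obtain ⟨B, hB, hB'⟩ := hU w hw hr
  refine ⟨B, hB, ?_⟩
  rw [← h w hwK, hB', ← h u hu]
  congr 1
  rw [Finset.filter_congr (q := fun u' => G.Adj w u' ∧ (ω' u').1.1 = (ω u).1.1)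
    fun u' hu' => by rw [h u' (hPK hu')]]
  refine Finset.image_congr fun u' hu' => ?_
  rw [h u' (hPK (Finset.mem_filter.1 hu').1)]

/-- A choice of seeds for which every active node learns all labels. -/
def GoodSeeds (K P : Finset V) (g : ℕ) (ω : V → PermSeed m Q F) : Prop :=
  (∀ i, (P.filter fun u => (ω u).1.1 = i).card ≤ g) ∧ Set.InjOn (fun u => (ω u).1.2) P ∧
    ∀ u ∈ P, ∀ v ∈ K, RelaysDetermine G e K P (2 * g) ω u v

lemma GoodSeeds.congr {K P : Finset V} (hPK : P ⊆ K) {g : ℕ} {ω ω' : V → PermSeed m Q F}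
    (h : ∀ v ∈ K, ω v = ω' v) (hω : GoodSeeds G e K P g ω) : GoodSeeds G e K P g ω' := by
  obtain ⟨h1, h2, h3⟩ := hω
  refine ⟨fun i => ?_, ?_, fun u hu v hv U hU hadm => ?_⟩
  · rw [Finset.filter_congr (q := fun u => (ω u).1.1 = i) fun u hu => by rw [h u (hPK hu)]]
    exact h1 i
  · exact h2.congr fun u hu => by simp only [h u (hPK hu)]
  · rw [← h u (hPK hu)]
    exact h3 u hu v hv U hU (hadm.congr G e hPK (fun v hv => (h v hv).symm) (hPK hu))

lemma uprob_not_goodSeeds_le [Fintype V] [Fintype F] [NeZero m] [NeZero Q] {K P : Finset V}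
    (hPK : P ⊆ K) {g D X l : ℕ} {δ : ℝ} (hδ : 0 ≤ δ)
    (hF : 2 ^ (D * X) * (2 ^ (2 * g) * (P.card + 2 * g)) ≤ Fintype.card F)
    (hfew : ∀ u ∈ K, ∀ v ∈ K, ∀ i : Fin m, uprob (fun ω : V → PermSeed m Q F =>
      D * relayCount G K ω u v i < l) ≤ δ) :
    uprob (fun ω : V → PermSeed m Q F => ¬ GoodSeeds G e K P g ω) ≤
      m * (2⁻¹ ^ g * (1 + 1 / (m : ℝ)) ^ P.card) + ((P.card : ℝ) ^ 2 * (1 / (Q : ℝ)) +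
        (K.card : ℝ) ^ 2 * (m * δ + (Q + 1) ^ (2 * g) * 2⁻¹ ^ (X * l))) := by
  refine le_trans ?_ (add_le_add (uprob_exists_overloaded_le (F := F) (Q := Q) P g) (add_le_add
    (uprob_not_injOn_label_le (F := F) (m := m) (Q := Q) P)
    (uprob_exists_not_relaysDetermine_le G e K P hPK hδ hF hfew)))
  refine le_trans ?_ ((uprob_or_le _ _).trans (add_le_add le_rfl (uprob_or_le _ _)))
  refine uprob_mono fun ω h => ?_
  by_contra! hcon
  exact h ⟨hcon.1, hcon.2.1, hcon.2.2⟩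

end Congruence

/-! ### The two claims, conditionally on the seeds outside the almost-clique. -/

section Specification

open Classical in
/-- The samples `ω` inside `K` and `ω₀` outside. -/
noncomputable def glueSeeds {V R : Type*} (K : Set V) (ω ω₀ : V → R) (v : V) : R :=
  if v ∈ K then ω v else ω₀ v

lemma glueSeeds_of_mem {V R : Type*} {K : Set V} {ω ω₀ : V → R} {v : V} (hv : v ∈ K) :
    glueSeeds K ω ω₀ v = ω v := if_pos hv

variable {V : Type*} [Fintype V] {N b m Q : ℕ} [NeZero m] [NeZero Q] {F : Type} [Field F]
  [Fintype F] {enc : PermMsg N m Q F → Msg b} (e : Fin Q ↪ F) (g : ℕ) (G : SimpleGraph V)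
  {ident : V → Fin N} {clique : V → Option (Fin N)} {S : Set V} {j : Fin N}

open Classical in
lemma uprob_goodSeeds_le_probGivenOutside (henc : Function.Injective enc)
    (hid : Function.Injective ident) {K : Finset V} (hK : ∀ v, v ∈ K ↔ clique v = some j)
    (ω₀ : V → PermSeed m Q F) :
    uprob (fun ω : V → PermSeed m Q F => GoodSeeds G e K (K.filter (· ∈ S)) g ω) ≤
      (permProtocol enc e g).probGivenOutside {v | clique v = some j} ω₀
        {ω | ∃ π : ↥(S ∩ {v | clique v = some j}) ≃ Fin (S ∩ {v | clique v = some j}).ncard,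
          OutputsPerm (S ∩ {v | clique v = some j}) ((permProtocol enc e g).outputAfter G ident
            (fun v => ⟨ident v, clique v, v ∈ S⟩) ω 2) π} := by
  change _ ≤ uprob fun ω : V → PermSeed m Q F => glueSeeds {v | clique v = some j} ω ω₀ ∈ _
  refine uprob_mono fun ω hω => ?_
  obtain ⟨h1, h2, h3⟩ := hω.congr G e (Finset.filter_subset _ _)
    (ω' := glueSeeds {v | clique v = some j} ω ω₀)
    (fun v hv => (glueSeeds_of_mem (K := {v | clique v = some j}) ((hK v).1 hv)).symm)
  refine exists_outputsPerm_of_rank (P := K.filter (· ∈ S)) (fun v => ?_) h2 fun v hv => ?_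
  · rw [Finset.mem_filter, hK, and_comm]; rfl
  · exact permProtocol_output_eq_rank e g G henc hid hK h1 h2 h3 hv

open Classical in
lemma probGivenOutside_outputsPerm_le (henc : Function.Injective enc)
    (hid : Function.Injective ident) {K : Finset V} (hK : ∀ v, v ∈ K ↔ clique v = some j)
    (hhalf : ∀ T ⊆ K, 2 * g < T.card → ∃ w ∈ K, g < (T.filter fun u => G.Adj w u).card)
    (ω₀ : V → PermSeed m Q F)
    (π : ↥(S ∩ {v | clique v = some j}) ≃ Fin (S ∩ {v | clique v = some j}).ncard) :
    (permProtocol enc e g).probGivenOutside {v | clique v = some j} ω₀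
        {ω | OutputsPerm (S ∩ {v | clique v = some j}) ((permProtocol enc e g).outputAfter G ident
            (fun v => ⟨ident v, clique v, v ∈ S⟩) ω 2) π} ≤
      1 / ((S ∩ {v | clique v = some j}).ncard.factorial : ℝ) := by
  change (uprob fun ω : V → PermSeed m Q F => glueSeeds {v | clique v = some j} ω ω₀ ∈ _) ≤ _
  refine le_trans (uprob_mono fun ω hω => ?_)
    (uprob_strictMono_le (V := V) (fun s : PermSeed m Q F => s.1.2) π)
  have hP : ∀ v, v ∈ K.filter (· ∈ S) ↔ v ∈ S ∩ {v | clique v = some j} := fun v => by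
    rw [Finset.mem_filter, hK, and_comm]; rfl
  have hmono := OutputsPerm.strictMono hP
    (y := fun v => (glueSeeds {v | clique v = some j} ω ω₀ v).1.2) hω
    fun v hv r hr => permProtocol_output_le_rank e g G henc hid hK hhalf (fun u hu h => by
      have := hω ⟨u, (hP u).1 hu⟩
      rw [h] at this
      cases this) hv hr
  intro i i' hii
  have := hmono hii
  simp only at this
  rwa [glueSeeds_of_mem (π.symm i).2.2, glueSeeds_of_mem (π.symm i').2.2] at this

end Specification

/-! ### Choice of constants and the resulting estimates. -/

section Parameters

/-- The relays available per group, up to a constant and a logarithmic factor. -/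
def relayFactor (r : ℕ) : ℕ := 5 * (r + 8)

/-- The bound on the load of a group, up to a logarithmic factor. -/
def loadFactor (r : ℕ) : ℕ := 4 * relayFactor r + 5 + r

/-- The reliability of a report, up to a logarithmic factor. -/
def reportFactor (r : ℕ) : ℕ := (r + 5) * (2 * loadFactor r) + r + 4

/-- The length of a fingerprint, up to a logarithmic factor. -/
def fieldFactor (r D : ℕ) : ℕ := D * reportFactor r + 4 * loadFactor r + 1

/-- The number of groups. -/
def groupCount (r n Δ : ℕ) : ℕ := min Δ (2 * n) / (relayFactor r * (Nat.log 2 n + 1)) + 1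

/-- The message length, up to a logarithmic factor. -/
def messageFactor (r D κ : ℕ) : ℕ := (κ + r + 9) + (κ + 5 + 2 * fieldFactor r D)

instance (r n Δ : ℕ) : NeZero (groupCount r n Δ) := ⟨Nat.succ_ne_zero _⟩

lemma lt_two_pow_log_add_one (n : ℕ) : n < 2 ^ (Nat.log 2 n + 1) :=
  Nat.lt_pow_succ_log_self (by norm_num) n

/-- The cap `2 * n` in `groupCount` keeps group names logarithmic for every `Δ`. It changes nothing
when a nonempty almost-clique is present, because then `Δ ≤ 2 * n`. -/
lemma groupCount_le (r n Δ : ℕ) : groupCount r n Δ ≤ 2 ^ (3 * (Nat.log 2 n + 1)) := by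
  have h1 := lt_two_pow_log_add_one n
  have h2 : groupCount r n Δ ≤ 2 * n + 1 :=
    Nat.succ_le_succ ((Nat.div_le_self _ _).trans (min_le_right _ _))
  calc _ ≤ 2 * n + 1 := h2
    _ ≤ 2 ^ (Nat.log 2 n + 1) * 2 := by omega
    _ = 2 ^ (Nat.log 2 n + 1 + 1) := by rw [pow_succ 2 (Nat.log 2 n + 1)]
    _ ≤ _ := Nat.pow_le_pow_right (by norm_num) (by omega)

lemma card_permMsg_le (κ r D n : ℕ) {m Q : ℕ} {F : Type} [Fintype F]
    (hm : m ≤ 2 ^ (3 * (Nat.log 2 n + 1))) (hQ : Q = 2 ^ ((r + 4) * (Nat.log 2 n + 1)))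
    (hF : Fintype.card F = 2 ^ (fieldFactor r D * (Nat.log 2 n + 1))) :
    Fintype.card (PermMsg (n ^ κ) m Q F) ≤
      2 ^ (messageFactor r D κ * (Nat.log 2 n + 1)) := by
  set l := Nat.log 2 n + 1
  have hl : 1 ≤ l := by omega
  have hn : n ^ κ + 1 ≤ 2 ^ ((κ + 1) * l) := by
    have h1 : n ^ κ ≤ 2 ^ (κ * l) := by
      rw [mul_comm, pow_mul]
      exact Nat.pow_le_pow_left (lt_two_pow_log_add_one n).le _
    have h2 : 2 ≤ 2 ^ l := by
      calc 2 = 2 ^ 1 := rfl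
        _ ≤ _ := Nat.pow_le_pow_right (by norm_num) hl
    have h3 : 1 ≤ 2 ^ (κ * l) := Nat.one_le_two_pow
    rw [add_mul, one_mul, pow_add]
    nlinarith
  have h2 : 2 ≤ 2 ^ l := by
    calc 2 = 2 ^ 1 := rfl
      _ ≤ _ := Nat.pow_le_pow_right (by norm_num) hl
  simp only [PermMsg, Fintype.card_sum, Fintype.card_prod, Fintype.card_option, Fintype.card_fin,
    Fintype.card_bool, hF, hQ]
  set f := fieldFactor r D
  -- `hA` counts the greetings and `hB` the reports.
  have hA : (n ^ κ + 1) * (2 * (m * 2 ^ ((r + 4) * l))) ≤ 2 ^ ((κ + r + 9) * l) := by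
    calc _ ≤ 2 ^ ((κ + 1) * l) * (2 ^ l * (2 ^ (3 * l) * 2 ^ ((r + 4) * l))) := by gcongr
      _ = _ := by rw [← pow_add, ← pow_add, ← pow_add]; congr 1; ring
  have hB : (n ^ κ + 1) * (m * (2 ^ (f * l) * (2 ^ (f * l) * 2))) ≤ 2 ^ ((κ + 5 + 2 * f) * l) := by
    calc _ ≤ 2 ^ ((κ + 1) * l) * (2 ^ (3 * l) * (2 ^ (f * l) * (2 ^ (f * l) * 2 ^ l))) := by gcongr
      _ = _ := by rw [← pow_add, ← pow_add, ← pow_add, ← pow_add]; congr 1; ring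
  have h1 : ∀ a b : ℕ, 1 ≤ a → 1 ≤ b → 2 ^ (a * l) + 2 ^ (b * l) ≤ 2 ^ ((a + b) * l) := by
    intro a b ha hb
    have h3 : 2 ≤ 2 ^ (a * l) := h2.trans (Nat.pow_le_pow_right (by norm_num) (by nlinarith))
    have h4 : 2 ≤ 2 ^ (b * l) := h2.trans (Nat.pow_le_pow_right (by norm_num) (by nlinarith))
    rw [add_mul, pow_add]
    nlinarith
  exact (add_le_add hA hB).trans (h1 _ _ (by omega) (by omega))

lemma fingerprint_field_large (r D n : ℕ) {p : ℕ} (hp : p ≤ n) :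
    2 ^ (D * (reportFactor r * (Nat.log 2 n + 1))) *
      (2 ^ (2 * (loadFactor r * (Nat.log 2 n + 1))) *
        (p + 2 * (loadFactor r * (Nat.log 2 n + 1)))) ≤
      2 ^ (fieldFactor r D * (Nat.log 2 n + 1)) := by
  have hn := lt_two_pow_log_add_one n
  set l := Nat.log 2 n + 1
  have hl : 1 ≤ l := by omega
  have h0 : 1 ≤ loadFactor r := by unfold loadFactor; omega
  set g := 2 * (loadFactor r * l) with hg
  have h1 : p + g ≤ 2 ^ (l + g) := by
    have h2 : g < 2 ^ g := Nat.lt_two_pow_self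
    have h3 : 2 ≤ 2 ^ l := by
      calc 2 = 2 ^ 1 := rfl
        _ ≤ _ := Nat.pow_le_pow_right (by norm_num) hl
    have h4 : 2 ≤ 2 ^ g := by
      calc 2 = 2 ^ 1 := rfl
        _ ≤ _ := Nat.pow_le_pow_right (by norm_num) (by nlinarith)
    rw [pow_add]
    nlinarith
  calc _ ≤ 2 ^ (D * (reportFactor r * l)) * (2 ^ g * 2 ^ (l + g)) := by gcongr
    _ = _ := by
      rw [← pow_add, ← pow_add]
      congr 1
      rw [hg, fieldFactor]
      ring

lemma exp_neg_natCast_le (k : ℕ) : Real.exp (-(k : ℝ)) ≤ 2⁻¹ ^ k := by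
  rw [← mul_one (k : ℝ), ← mul_neg, Real.exp_nat_mul, Real.exp_neg]
  gcongr
  linarith [Real.exp_one_gt_d9]

/-- Bound on the probability that a group is overloaded. -/
lemma overloaded_bound {r n Δ p : ℕ} (hΔ : Δ ≤ 2 * n) (hp : p ≤ 2 * Δ) :
    (groupCount r n Δ : ℝ) * (2⁻¹ ^ (loadFactor r * (Nat.log 2 n + 1)) *
      (1 + 1 / (groupCount r n Δ : ℝ)) ^ p) ≤ 2⁻¹ ^ ((r + 2) * (Nat.log 2 n + 1)) := by
  have hm := groupCount_le r n Δ
  set l := Nat.log 2 n + 1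
  have hmpos : 0 < groupCount r n Δ := Nat.succ_pos _
  have hC : 0 < relayFactor r * l := by
    have : 1 ≤ relayFactor r := by unfold relayFactor; omega
    positivity
  have hΔm : Δ ≤ groupCount r n Δ * (relayFactor r * l) := by
    unfold groupCount
    rw [min_eq_left hΔ]
    exact (Nat.lt_mul_div_succ Δ hC).le.trans (le_of_eq (mul_comm _ _))
  set m := groupCount r n Δ
  have hm' : (m : ℝ) ≤ 2 ^ (3 * l) := by exact_mod_cast hm
  have hmr : (0 : ℝ) < m := by exact_mod_cast hmpos
  -- This uses `(1 + 1/m) ^ m ≤ e < 4` and `p ≤ 2Δ`. The remainder of `loadFactor` is `3` for the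
  -- number of groups and `r + 2` for the target.
  have h1 : (1 + 1 / (m : ℝ)) ^ p ≤ 2 ^ (4 * (relayFactor r * l)) := by
    have hp' : p ≤ m * (2 * (relayFactor r * l)) := by nlinarith
    calc (1 + 1 / (m : ℝ)) ^ p ≤ (1 + 1 / (m : ℝ)) ^ (m * (2 * (relayFactor r * l))) :=
          pow_le_pow_right₀ (by simp) hp'
      _ = ((1 + 1 / (m : ℝ)) ^ m) ^ (2 * (relayFactor r * l)) := by rw [pow_mul]
      _ ≤ 4 ^ (2 * (relayFactor r * l)) := by
        gcongr
        calc (1 + 1 / (m : ℝ)) ^ m ≤ Real.exp (1 / m) ^ m := by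
              gcongr
              rw [add_comm]; exact Real.add_one_le_exp _
          _ = Real.exp 1 := by
              rw [← Real.exp_nat_mul]; congr 1; field_simp
          _ ≤ 4 := by linarith [Real.exp_one_lt_d9]
      _ = _ := by
        rw [show (4 : ℝ) = 2 ^ 2 by norm_num, ← pow_mul]; congr 1; ring
  calc _ ≤ (2 : ℝ) ^ (3 * l) * (2⁻¹ ^ (loadFactor r * l) * 2 ^ (4 * (relayFactor r * l))) := by
        gcongr
    _ = _ := by
        rw [show loadFactor r * l = (r + 2) * l + (3 * l + 4 * (relayFactor r * l)) by
          unfold loadFactor; ring, pow_add 2⁻¹, inv_pow 2 (3 * l + _), pow_add 2 (3 * l)]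
        field_simp

lemma collision_bound {r n p : ℕ} (hp : p ≤ n) :
    (p : ℝ) ^ 2 * (1 / ((2 ^ ((r + 4) * (Nat.log 2 n + 1)) : ℕ) : ℝ)) ≤
      2⁻¹ ^ ((r + 2) * (Nat.log 2 n + 1)) := by
  have hn := lt_two_pow_log_add_one n
  set l := Nat.log 2 n + 1
  have hp' : (p : ℝ) ≤ 2 ^ l := by exact_mod_cast hp.trans hn.le
  calc _ ≤ ((2 : ℝ) ^ l) ^ 2 * (1 / ((2 ^ ((r + 4) * l) : ℕ) : ℝ)) := by gcongr
    _ = _ := by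
      rw [show (r + 4) * l = (r + 2) * l + l * 2 by ring, ← pow_mul]
      push_cast
      rw [pow_add, inv_pow]
      field_simp

lemma few_relays_bound_sum {r n m k : ℕ} (hk : k ≤ n) (hm : m ≤ 2 ^ (3 * (Nat.log 2 n + 1))) :
    (k : ℝ) ^ 2 * (m * (2 ^ (Nat.log 2 n + 1) * 2⁻¹ ^ ((r + 8) * (Nat.log 2 n + 1)))) ≤
      2⁻¹ ^ ((r + 2) * (Nat.log 2 n + 1)) := by
  have hn := lt_two_pow_log_add_one n
  set l := Nat.log 2 n + 1
  have hk' : (k : ℝ) ≤ 2 ^ l := by exact_mod_cast hk.trans hn.le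
  have hm' : (m : ℝ) ≤ 2 ^ (3 * l) := by exact_mod_cast hm
  clear_value l
  calc _ ≤ ((2 : ℝ) ^ l) ^ 2 * (2 ^ (3 * l) * (2 ^ l * 2⁻¹ ^ ((r + 8) * l))) := by gcongr
    _ = _ := by
      rw [show (r + 8) * l = (r + 2) * l + (l * 2 + 3 * l + l) by ring, ← pow_mul,
        pow_add 2⁻¹, inv_pow 2 (l * 2 + 3 * l + l), pow_add, pow_add]
      field_simp

lemma wrong_set_bound_sum {r n k : ℕ} (hk : k ≤ n) :
    (k : ℝ) ^ 2 * ((((2 ^ ((r + 4) * (Nat.log 2 n + 1)) : ℕ) : ℝ) + 1) ^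
      (2 * (loadFactor r * (Nat.log 2 n + 1))) *
        2⁻¹ ^ ((reportFactor r * (Nat.log 2 n + 1)) * (Nat.log 2 n + 1))) ≤
      2⁻¹ ^ ((r + 2) * (Nat.log 2 n + 1)) := by
  have hn := lt_two_pow_log_add_one n
  set l := Nat.log 2 n + 1
  have hl : 1 ≤ l := by omega
  have hk' : (k : ℝ) ≤ 2 ^ l := by exact_mod_cast hk.trans hn.le
  have hQ : (((2 ^ ((r + 4) * l) : ℕ) : ℝ) + 1) ≤ 2 ^ ((r + 5) * l) := by
    have h2 : 2 ≤ 2 ^ l := by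
      calc 2 = 2 ^ 1 := rfl
        _ ≤ _ := Nat.pow_le_pow_right (by norm_num) hl
    have h3 : 1 ≤ 2 ^ ((r + 4) * l) := Nat.one_le_two_pow
    have : 2 ^ ((r + 4) * l) + 1 ≤ 2 ^ ((r + 5) * l) := by
      rw [show (r + 5) * l = (r + 4) * l + l by ring, pow_add]
      nlinarith
    exact_mod_cast this
  calc _ ≤ ((2 : ℝ) ^ l) ^ 2 * ((2 ^ ((r + 5) * l)) ^ (2 * (loadFactor r * l)) *
        2⁻¹ ^ ((reportFactor r * l) * l)) := by gcongr
    -- The first summand of `reportFactor` cancels the number of candidate sets exactly; the summand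
    -- `r + 4` is left for `k ^ 2` and the target.
    _ = 2⁻¹ ^ ((r + 4) * l * l) * 2 ^ (l * 2) := by
      rw [show reportFactor r * l * l = (r + 4) * l * l + (r + 5) * l * (2 * (loadFactor r * l)) by
        unfold reportFactor; ring, ← pow_mul, ← pow_mul, pow_add 2⁻¹,
        inv_pow 2 ((r + 5) * l * (2 * (loadFactor r * l)))]
      field_simp
    _ ≤ 2⁻¹ ^ ((r + 2) * l + l * 2) * 2 ^ (l * 2) := by
      gcongr ?_ * _
      exact pow_le_pow_of_le_one (by norm_num) (by norm_num) (by
        have := Nat.le_mul_of_pos_right ((r + 4) * l) hl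
        linarith)
    _ = _ := by
      rw [pow_add, inv_pow 2 (l * 2)]
      field_simp

-- With a single group every common neighbor is a relay, and the factor `D` makes up for a `Δ` that
-- is small compared with the logarithm. Otherwise the number of groups is at most `2Δ /
-- (relayFactor r * l)`, and the lower tail applies; the 5 in `relayFactor` suffices since `7/8 *
-- 5/4 > 1`.
open Classical in
lemma uprob_few_relays_le {V : Type*} [Fintype V] (G : SimpleGraph V) {r n Δ D Q : ℕ} [NeZero Q]
    {F : Type} [Field F] [Fintype F] (hΔ : Δ ≤ 2 * n) (hD : 1 ≤ D)
    (hDΔ : ((Nat.log 2 n + 1 : ℕ) : ℝ) ≤ D * (7 / 8 * Δ)) {K : Finset V} {u v : V}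
    (hcommon : 7 / 8 * (Δ : ℝ) ≤
      (K.filter fun w => G.Adj w u ∧ G.Adj v w).card)
    (i : Fin (groupCount r n Δ)) :
    uprob (fun ω : V → PermSeed (groupCount r n Δ) Q F =>
      D * relayCount G K ω u v i < Nat.log 2 n + 1) ≤
      2 ^ (Nat.log 2 n + 1) * 2⁻¹ ^ ((r + 8) * (Nat.log 2 n + 1)) := by
  set l := Nat.log 2 n + 1 with hl
  by_cases hone : groupCount r n Δ = 1
  · refine le_trans (le_of_eq ?_) (by positivity :
      (0 : ℝ) ≤ 2 ^ l * 2⁻¹ ^ ((r + 8) * l))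
    have hall : ∀ ω : V → PermSeed (groupCount r n Δ) Q F, ¬ D * relayCount G K ω u v i < l := by
      intro ω
      rw [not_lt, relayCount, Finset.filter_true_of_mem]
      · have : (D : ℝ) * (7 / 8 * Δ) ≤
            D * (K.filter (fun w => G.Adj w u ∧ G.Adj v w)).card := by gcongr
        exact_mod_cast hDΔ.trans this
      · intro w _
        exact Fin.ext (by omega)
    simp [uprob, hall]
  · have hC : 0 < relayFactor r * l := by
      have : 1 ≤ relayFactor r := by unfold relayFactor; omega
      positivity
    have hm : groupCount r n Δ * (relayFactor r * l) ≤ 2 * Δ := by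
      unfold groupCount at hone ⊢
      rw [min_eq_left hΔ] at hone ⊢
      have h1 := Nat.div_mul_le_self Δ (relayFactor r * l)
      have h2 : relayFactor r * l ≤ Δ := by
        by_contra! hlt
        exact hone (by rw [Nat.div_eq_of_lt hlt])
      rw [← hl, add_mul]
      omega
    have hmpos : (0 : ℝ) < groupCount r n Δ := by exact_mod_cast Nat.succ_pos _
    refine (uprob_mono fun ω h => ?_).trans ((uprob_card_filter_eq_lt_le
      (fun s : PermSeed (groupCount r n Δ) Q F => s.2.1) i (card_role_filter_mul i)
      (K.filter (fun w => G.Adj w u ∧ G.Adj v w)) l).trans ?_)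
    · exact (Nat.le_mul_of_pos_left _ hD).trans_lt h
    · set M := (K.filter (fun w => G.Adj w u ∧ G.Adj v w)).card
      set m := groupCount r n Δ
      gcongr
      have hm1 : (1 : ℝ) ≤ m := by exact_mod_cast Nat.succ_le_succ (Nat.zero_le _)
      calc (1 - 1 / (2 * m : ℝ)) ^ M ≤ Real.exp (-(1 / (2 * m : ℝ))) ^ M := by
            gcongr
            · rw [sub_nonneg, div_le_one (by positivity)]
              linarith
            · linarith [Real.add_one_le_exp (-(1 / (2 * m : ℝ)))]
        _ = Real.exp (-(M / (2 * m : ℝ))) := by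
            rw [← Real.exp_nat_mul]; congr 1; field_simp
        _ ≤ Real.exp (-(((r + 8) * l : ℕ) : ℝ)) := by
            gcongr
            rw [le_div_iff₀ (by positivity)]
            have hm' : (m : ℝ) * (5 * (r + 8) * l) ≤ 2 * Δ := by
              unfold relayFactor at hm
              exact_mod_cast hm
            have h0 : (0 : ℝ) ≤ m * ((r + 8) * l) := by positivity
            push_cast
            nlinarith
        _ ≤ _ := exp_neg_natCast_le _

end Parameters

/-! ### Assembly. -/

/-- The degree bound exceeds any given small multiple of the logarithm of the number of nodes. -/
lemma exists_log_le_mul {a : ℝ} (ha : 0 < a) : ∃ D : ℕ, 1 ≤ D ∧ ∀ n Δ : ℕ, 2 ≤ n →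
    a * Real.log n ^ 3 ≤ Δ → ((Nat.log 2 n + 1 : ℕ) : ℝ) ≤ D * (7 / 8 * Δ) := by
  have hln2 : 0 < Real.log 2 := Real.log_pos (by norm_num)
  -- Chosen to match `a * (ln 2)³ * (log₂ n + 1) ≤ 2Δ`, which is `h5` below.
  obtain ⟨D, hD⟩ := exists_nat_ge (16 / (7 * (a * Real.log 2 ^ 3)))
  have hDpos : (0 : ℝ) < D := lt_of_lt_of_le (by positivity) hD
  refine ⟨D, by exact_mod_cast hDpos, fun n Δ hn hΔ => ?_⟩
  have hnr : (2 : ℝ) ≤ n := by exact_mod_cast hn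
  have h1 : Real.log 2 ≤ Real.log n := Real.log_le_log (by norm_num) hnr
  have h2 : (Nat.log 2 n : ℝ) * Real.log 2 ≤ Real.log n := by
    rw [← Real.log_pow]
    refine Real.log_le_log (by positivity) ?_
    exact_mod_cast Nat.pow_log_le_self 2 (by omega)
  have h3 : ((Nat.log 2 n + 1 : ℕ) : ℝ) * Real.log 2 ≤ 2 * Real.log n := by
    push_cast; linarith
  have h4 : Real.log 2 ^ 2 * Real.log n ≤ Real.log n ^ 3 := by
    have : Real.log 2 ^ 2 ≤ Real.log n ^ 2 := by gcongr
    nlinarith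
  have h5 : a * Real.log 2 ^ 3 * ((Nat.log 2 n + 1 : ℕ) : ℝ) ≤ 2 * Δ := by
    have h6 : a * Real.log 2 ^ 2 * (((Nat.log 2 n + 1 : ℕ) : ℝ) * Real.log 2) ≤
        a * Real.log 2 ^ 2 * (2 * Real.log n) := by gcongr
    have h7 : a * (Real.log 2 ^ 2 * Real.log n) ≤ a * Real.log n ^ 3 := by gcongr
    nlinarith
  have h8 : 16 ≤ D * (7 * (a * Real.log 2 ^ 3)) := (div_le_iff₀ (by positivity)).1 hD
  have hl : (0 : ℝ) ≤ ((Nat.log 2 n + 1 : ℕ) : ℝ) := by positivity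
  have h9 := mul_le_mul_of_nonneg_right h8 hl
  have h10 := mul_le_mul_of_nonneg_left h5 (by positivity : (0 : ℝ) ≤ D * 7)
  nlinarith

lemma two_inv_pow_le_rpow {c : ℝ} {n : ℕ} (hn : 1 ≤ n) :
    (2⁻¹ : ℝ) ^ (⌈c⌉₊ * (Nat.log 2 n + 1)) ≤ (n : ℝ) ^ (-c) := by
  have hn1 : (1 : ℝ) ≤ n := by exact_mod_cast hn
  rw [Real.rpow_neg (by positivity), inv_pow]
  have h1 : (n : ℝ) ^ c ≤ (n : ℝ) ^ ⌈c⌉₊ := by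
    rw [← Real.rpow_natCast]
    exact Real.rpow_le_rpow_of_exponent_le hn1 (Nat.le_ceil c)
  refine inv_anti₀ (by positivity) (h1.trans ?_)
  rw [mul_comm, pow_mul]
  gcongr
  exact_mod_cast (lt_two_pow_log_add_one n).le

open Classical in
lemma uprob_not_goodSeeds_le_rpow {V : Type*} [Fintype V] (G : SimpleGraph V) {c : ℝ}
    {n Δ D : ℕ} {F : Type} [Field F] [Fintype F]
    (hF : Fintype.card F = 2 ^ (fieldFactor ⌈c⌉₊ D * (Nat.log 2 n + 1)))
    (e : Fin (2 ^ ((⌈c⌉₊ + 4) * (Nat.log 2 n + 1))) ↪ F) (hn : 2 ≤ n) (hΔ : Δ ≤ 2 * n)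
    (hD : 1 ≤ D) (hDΔ : ((Nat.log 2 n + 1 : ℕ) : ℝ) ≤ D * (7 / 8 * Δ)) {K P : Finset V}
    (hPK : P ⊆ K) (hKn : K.card ≤ n) (hKΔ : K.card ≤ 2 * Δ)
    (hcommon : ∀ u ∈ K, ∀ v ∈ K,
      7 / 8 * (Δ : ℝ) ≤ (K.filter fun w => G.Adj w u ∧ G.Adj v w).card) :
    uprob (fun ω : V → PermSeed (groupCount ⌈c⌉₊ n Δ) _ F =>
      ¬ GoodSeeds G e K P (loadFactor ⌈c⌉₊ * (Nat.log 2 n + 1)) ω) ≤ (n : ℝ) ^ (-c) := by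
  have hP := Finset.card_le_card hPK
  refine (uprob_not_goodSeeds_le G e hPK
    (δ := 2 ^ (Nat.log 2 n + 1) * 2⁻¹ ^ ((⌈c⌉₊ + 8) * (Nat.log 2 n + 1)))
    (D := D) (X := reportFactor ⌈c⌉₊ * (Nat.log 2 n + 1)) (l := Nat.log 2 n + 1) (by positivity)
    ?_ fun u hu v hv i => ?_).trans ?_
  · rw [hF]
    exact fingerprint_field_large _ _ _ (hP.trans hKn)
  · exact uprob_few_relays_le G hΔ hD hDΔ (hcommon u hu v hv) i
  · rw [mul_add ((K.card : ℝ) ^ 2)]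
    refine (add_le_add (overloaded_bound hΔ (hP.trans hKΔ)) (add_le_add
      (collision_bound (hP.trans hKn)) (add_le_add (few_relays_bound_sum hKn (groupCount_le _ _ _))
      (wrong_set_bound_sum hKn)))).trans (le_trans ?_ (two_inv_pow_le_rpow (by omega)))
    set l := Nat.log 2 n + 1
    -- The surplus exponent 2 absorbs the sum of four error terms.
    have h4 : (2⁻¹ : ℝ) ^ ((⌈c⌉₊ + 2) * l) ≤ 2⁻¹ ^ (⌈c⌉₊ * l + 2) :=
      pow_le_pow_of_le_one (by norm_num) (by norm_num) (by
        have : 1 ≤ l := by omega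
        nlinarith)
    rw [pow_add] at h4
    norm_num at h4 ⊢
    linarith

open Classical in
/-- The sizes and degrees of a nonempty almost-clique, in terms of finite sets. -/
lemma IsAlmostClique.filter_bounds {V : Type*} [Fintype V] {G : SimpleGraph V} {ε : ℝ} {Δ : ℕ}
    {K : Finset V} (hK : IsAlmostClique G ε Δ (K : Set V)) :
    (K.card : ℝ) ≤ (1 + ε) * Δ ∧
      ∀ u ∈ K, (1 - ε) * Δ ≤ ((K.filter fun w => G.Adj u w).card : ℝ) := by
  refine ⟨by simpa using hK.card_le, fun u hu => ?_⟩
  have h := hK.inside u hu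
  rwa [show G.neighborSet u ∩ (K : Set V) = ((K.filter fun w => G.Adj u w : Finset V) : Set V) by
    ext w; simp [and_comm], Set.ncard_coe_finset] at h

lemma exists_field_card (k : ℕ) (hk : k ≠ 0) :
    ∃ (F : Type) (_ : Field F) (_ : Fintype F), Fintype.card F = 2 ^ k :=
  ⟨GaloisField 2 k, inferInstance, Fintype.ofFinite _, by
    rw [← GaloisField.card 2 k hk, Fintype.card_eq_nat_card]⟩

theorem mainTheorem3 (ε : ℝ) (hε0 : 0 < ε) (hε : ε < 1 / 24) (a : ℝ) (ha : 0 < a)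
    (c : ℝ) (hc : 0 < c) (κ : ℕ) :
    ∃ (T B : ℕ)
      (alg : (n _Δ : ℕ) →
        BCongest.Protocol (n ^ κ) (B * (Nat.log 2 n + 1)) (PermInput (n ^ κ)) (Option ℕ)),
      ∀ (V : Type*) [Fintype V] (G : SimpleGraph V) (n Δ : ℕ),
        Fintype.card V = n →
        (∀ v, (G.neighborSet v).ncard ≤ Δ) →
        a * Real.log n ^ 3 ≤ (Δ : ℝ) →
        ∀ (ident : V → Fin (n ^ κ)) (clique : V → Option (Fin (n ^ κ))) (S : Set V),
          Function.Injective ident →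
          (∀ j, IsAlmostClique G ε Δ {v | clique v = some j}) →
          ∀ (j : Fin (n ^ κ)) (ω₀ : V → (alg n Δ).Seed),
            let K : Set V := {v | clique v = some j}
            let inp : V → PermInput (n ^ κ) := fun v => ⟨ident v, clique v, v ∈ S⟩
            let out : (V → (alg n Δ).Seed) → V → Option ℕ :=
              fun ω => (alg n Δ).outputAfter G ident inp ω T
            let success : Set (V → (alg n Δ).Seed) :=
              {ω | ∃ π : ↥(S ∩ K) ≃ Fin (S ∩ K).ncard, OutputsPerm (S ∩ K) (out ω) π}
            1 - (n : ℝ) ^ (-c) ≤ (alg n Δ).probGivenOutside K ω₀ success ∧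
            ∀ π : ↥(S ∩ K) ≃ Fin (S ∩ K).ncard,
              (1 - (n : ℝ) ^ (-c)) *
                  (alg n Δ).probGivenOutside K ω₀ {ω | OutputsPerm (S ∩ K) (out ω) π}
                ≤ (alg n Δ).probGivenOutside K ω₀ success / ((S ∩ K).ncard.factorial : ℝ) := by
  obtain ⟨D, hD, hDlog⟩ := exists_log_le_mul ha
  set r := ⌈c⌉₊ with hr
  have hfactor : ∀ n, fieldFactor r D * (Nat.log 2 n + 1) ≠ 0 := fun n => by
    unfold fieldFactor; positivity
  choose F instF instFin hF using fun n => exists_field_card _ (hfactor n)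
  have hemb : ∀ n, Nonempty (Fin (2 ^ ((r + 4) * (Nat.log 2 n + 1))) ↪ F n) := fun n => by
    refine Function.Embedding.nonempty_of_card_le ?_
    rw [Fintype.card_fin, hF]
    refine Nat.pow_le_pow_right (by norm_num) (Nat.mul_le_mul_right _ ?_)
    have : reportFactor r ≤ D * reportFactor r := Nat.le_mul_of_pos_left _ hD
    have h4 : r + 4 ≤ reportFactor r := by unfold reportFactor; omega
    unfold fieldFactor
    omega
  have henc : ∀ n Δ, Nonempty (PermMsg (n ^ κ) (groupCount r n Δ)
      (2 ^ ((r + 4) * (Nat.log 2 n + 1))) (F n) ↪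
      Msg (messageFactor r D κ * (Nat.log 2 n + 1))) := fun n Δ => by
    refine Function.Embedding.nonempty_of_card_le ?_
    refine (card_permMsg_le κ r D n (groupCount_le r n Δ) rfl (hF n)).trans ?_
    simp
  refine ⟨2, messageFactor r D κ, fun n Δ => permProtocol (m := groupCount r n Δ) (henc n Δ).some
    (hemb n).some (loadFactor r * (Nat.log 2 n + 1)), ?_⟩
  intro V _ G n Δ hV hdeg hΔ ident clique S hid hclique j ω₀
  classical
  let K : Finset V := Finset.univ.filter fun v => clique v = some j
  have hK : ∀ v, v ∈ K ↔ clique v = some j := fun v => by simp [K]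
  have hKset : (K : Set V) = {v | clique v = some j} := by ext; simp [K]
  obtain ⟨hKcard, hKdeg⟩ := IsAlmostClique.filter_bounds (K := K) (by rw [hKset]; exact hclique j)
  have hinjenc := (henc n Δ).some.injective
  have hKn : K.card ≤ n := hV ▸ Finset.card_le_univ K
  have hgood := uprob_goodSeeds_le_probGivenOutside (hemb n).some
    (loadFactor r * (Nat.log 2 n + 1)) G (S := S) hinjenc hid hK ω₀
  have hnn : 0 ≤ 1 - (n : ℝ) ^ (-c) := by
    rcases Nat.eq_zero_or_pos n with h0 | h0
    · rw [h0, Nat.cast_zero, Real.zero_rpow (by linarith)]; norm_num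
    · linarith [Real.rpow_le_one_of_one_le_of_nonpos (x := n) (z := -c) (by exact_mod_cast h0)
        (by linarith)]
  have hΔpos : K.Nonempty → (0 : ℝ) < Δ := fun hne => by
    have : (0 : ℝ) < K.card := by exact_mod_cast hne.card_pos
    by_contra! hle
    nlinarith
  have hprob : 1 - (n : ℝ) ^ (-c) ≤ uprob (fun ω : V → PermSeed (groupCount r n Δ)
      (2 ^ ((r + 4) * (Nat.log 2 n + 1))) (F n) => GoodSeeds G (hemb n).some K (K.filter (· ∈ S))
        (loadFactor r * (Nat.log 2 n + 1)) ω) := by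
    -- An empty almost-clique does not bound `Δ` in terms of `n`, but every seed is good for it.
    rcases K.eq_empty_or_nonempty with hemp | hne
    · rw [uprob_eq_one_of_forall fun ω => by simp [GoodSeeds, hemp]]
      linarith [Real.rpow_nonneg (Nat.cast_nonneg n) (-c)]
    have hΔ0 := hΔpos hne
    obtain ⟨v, hv⟩ := hne
    rcases Nat.lt_or_ge n 2 with hn | hn
    -- For a single node the required probability is `1 - 1 = 0`.
    · have : n = 1 := by
        have := Fintype.card_pos_iff.2 ⟨v⟩
        omega
      rw [this, Nat.cast_one, Real.one_rpow, sub_self]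
      exact uprob_nonneg _
    · have hle : ((K.filter fun w => G.Adj v w).card : ℝ) ≤ n := by
        exact_mod_cast (Finset.card_le_card (Finset.filter_subset _ _)).trans hKn
      have hΔn : Δ ≤ 2 * n := by
        have := hKdeg v hv
        have h2 : (Δ : ℝ) ≤ 2 * n := by nlinarith
        exact_mod_cast h2
      have hKΔ : K.card ≤ 2 * Δ := by
        have h2 : (K.card : ℝ) ≤ 2 * Δ := by nlinarith
        exact_mod_cast h2
      have hbad := uprob_not_goodSeeds_le_rpow G (c := c) (hF n) (hemb n).some hn hΔn hD
        (hDlog n Δ hn hΔ) (Finset.filter_subset (· ∈ S) K) hKn hKΔ fun u hu v hv =>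
          -- Since `ε < 1/24`, the fraction `1 - 3ε` of common neighbors exceeds `7/8`.
          le_trans (by nlinarith) (le_card_common_neighbors G hKcard hKdeg hu hv)
      linarith [one_le_uprob_add_uprob_not fun ω : V → PermSeed (groupCount r n Δ)
        (2 ^ ((r + 4) * (Nat.log 2 n + 1))) (F n) => GoodSeeds G (hemb n).some K
          (K.filter (· ∈ S)) (loadFactor r * (Nat.log 2 n + 1)) ω]
  refine ⟨hprob.trans hgood, fun π => ?_⟩
  have hπ := probGivenOutside_outputsPerm_le (hemb n).some (loadFactor r * (Nat.log 2 n + 1)) G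
    hinjenc hid hK (fun T hTK hT => by
      have hne : K.Nonempty := (Finset.card_pos.1 (Nat.zero_le _ |>.trans_lt hT)).mono hTK
      exact exists_lt_card_filter_adj G hε (hΔpos hne) hTK hKcard hKdeg hT) ω₀ π
  refine (mul_le_mul_of_nonneg_left hπ hnn).trans ?_
  rw [mul_one_div]
  exact div_le_div_of_nonneg_right (hprob.trans hgood) (Nat.cast_nonneg _)
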